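/- **Setting.** Let $\mathcal X$ be a finite alphabet, $\gamma\ge 0$, $\{\psi_a\}_{a\in\mathcal C}$ a finite collection of symmetric functions $\psi_a:\mathcal X\times\mathcal X\to[0,\infty)$, and $p$ a probability distribution on $\mathcal C$. For $N\ge 1$ let $G_N$ be the random multigraph on $[N]$ in which, independently, the number of edges between two distinct vertices $i,j$ is Poisson of mean $2\gamma/N$ and the number of loops at $i$ is Poisson of mean $\gamma/N$; each edge $e$ carries an independent label $a(e)$ with law $p$. Let the root $r$ be uniform in $[N]$ and independent of $G_N$. For a finite multigraph $G$ on a vertex set $V$ with edges labelled in $\mathcal C$, let $$\mathbb P\{X=x\mid G\}=\frac1Z\prod_{e=(ij)}\psi_{a(e)}(x_i,x_j),\qquad x\in\mathcal X^V,$$ the product being over all edges with multiplicity, with $Z=Z(G)$ the normalizing constant. The measure is defined only if $Z(G)>0$; we assume that $\liminf_{N}\mathbb P\{Z(G_N)>0\}>0$ (for instance, all $\psi_a>0$), and structures with $Z=0$ are discarded, i.e. they contribute neither to the events nor to the expectation below. For a vertex $r$ and $t\ge 0$ let $\overline{\mathsf B}(r,t)$ be the set of vertices at graph distance at least $t$ from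 $r$ (infinite distance included), and $$D_t(G,r)=\big\|\mathbb P_{r,\overline{\mathsf B}(r,t)}\{\cdot,\cdot\mid G\}-\mathbb P_r\{\cdot\mid G\}\,\mathbb P_{\overline{\mathsf B}(r,t)}\{\cdot\mid G\}\big\|_{TV},$$ where $\mathbb P_U$ is the law of $X_U=(X_j)_{j\in U}$ and $\|p-q\|_{TV}=\frac12\sum_x|p_x-q_x|$. Events $A_n$ hold *with positive probability* if there are $\delta>0$ and infinitely many $n$ with $\mathbb P(A_n)\ge\delta$. *Graph reconstruction is solvable* if there is $\varepsilon>0$ such that, for every $t\ge0$, $D_t(G_N,r)\ge\varepsilon$ with positive probability (as $N\to\infty$). Let $\mathsf T_\ell$ be the truncation at depth $\ell$ of the Galton–Watson tree with Poisson$(2\gamma)$ offspring distribution, whose edges carry independent labels of law $p$. *Tree reconstruction is solvable* if there is $\varepsilon>0$ such that, for every $t\ge 0$, $D_t(\mathsf T_\ell,\mathrm{root})>\varepsilon$ with positive probability (as $\ell\to\infty$). Given $G_N$, let $X^{(1)},X^{(2)}$ be two independent assignments with law $\mathbb P\{\cdot\mid G_N\}$, let $\nu(x,y)$ be the fraction of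 vertices $j$ with $X^{(1)}_j=x$ and $X^{(2)}_j=y$, and let $\Delta\nu(x,y)=\nu(x,y)-|\mathcal X|^{-2}$. **Theorem 1.** Assume that for every $x\in\mathcal X$ $$\mathbb E\Big\{\Big[\Delta\nu(x,x)-\frac{2}{|\mathcal X|}\sum_{x'\in\mathcal X}\Delta\nu(x,x')\Big]^2\Big\}\longrightarrow 0\qquad(N\to\infty),$$ the expectation being over $G_N$ and the two replicas. Then graph reconstruction is solvable if and only if tree reconstruction is solvable. -/

import Mathlib

open MeasureTheory ProbabilityTheory Filter Topology
open scoped NNReal ENNReal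

/-! ### Finite multigraphs with labelled edges and their graphical models -/

/-- A finite multigraph on the vertex set `V` (loops and multiple edges allowed), every edge of
which carries a label in `C`. -/
structure LabeledMultigraph (V C : Type*) where
  /-- the set of edges -/
  Edge : Type
  /-- there are finitely many edges -/
  edgeFintype : Fintype Edge
  /-- the unordered pair of end points of an edge (a diagonal pair for a loop) -/
  ends : Edge → Sym2 V
  /-- the label of an edge -/
  label : Edge → C

attribute [instance] LabeledMultigraph.edgeFintype

namespace LabeledMultigraph

noncomputable section

variable {V C X : Type*}

/-- The simple graph underlying a multigraph; it has the same distances. -/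
def toSimpleGraph (G : LabeledMultigraph V C) : SimpleGraph V :=
  SimpleGraph.fromEdgeSet (Set.range G.ends)

/-- The vertices at distance at least `t` from `r` (vertices in other components are at infinite
distance). -/
def farSet (G : LabeledMultigraph V C) (r : V) (t : ℕ) : Set V :=
  {j | (t : ℕ∞) ≤ G.toSimpleGraph.edist r j}

/-- The unnormalized weight `∏_{edges (ij)} ψ_{ij}(x_i, x_j)` of an assignment `x`.  A symmetric
weight function of two variables is a function on unordered pairs; the edge with label `a` has
the weight function `ψ a`. -/
def weight (G : LabeledMultigraph V C) (ψ : C → Sym2 X → ℝ≥0) (x : V → X) : ℝ :=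
  ∏ e : G.Edge, (ψ (G.label e) ((G.ends e).map x) : ℝ)

open Classical in
/-- The partition function. -/
def partitionFunction [Fintype V] [Fintype X] (G : LabeledMultigraph V C)
    (ψ : C → Sym2 X → ℝ≥0) : ℝ :=
  ∑ x : V → X, G.weight ψ x

/-- The probability of the assignment `x` in the graphical model.  If the partition function
vanishes, the model is not defined and this is the zero function. -/
def gibbs [Fintype V] [Fintype X] (G : LabeledMultigraph V C) (ψ : C → Sym2 X → ℝ≥0)
    (x : V → X) : ℝ :=
  G.weight ψ x / G.partitionFunction ψ

open Classical in
/-- The probability that `X_r = a`. -/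
def rootMarginal [Fintype V] [Fintype X] (G : LabeledMultigraph V C) (ψ : C → Sym2 X → ℝ≥0)
    (r : V) (a : X) : ℝ :=
  ∑ x : V → X, if x r = a then G.gibbs ψ x else 0

open Classical in
/-- The probability that `X_U = y`. -/
def marginal [Fintype V] [Fintype X] (G : LabeledMultigraph V C) (ψ : C → Sym2 X → ℝ≥0)
    (U : Set V) (y : U → X) : ℝ :=
  ∑ x : V → X, if (fun j : U => x j) = y then G.gibbs ψ x else 0

open Classical in
/-- The probability that `X_r = a` and `X_U = y`. -/
def jointMarginal [Fintype V] [Fintype X] (G : LabeledMultigraph V C) (ψ : C → Sym2 X → ℝ≥0)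
    (r : V) (U : Set V) (a : X) (y : U → X) : ℝ :=
  ∑ x : V → X, if x r = a ∧ (fun j : U => x j) = y then G.gibbs ψ x else 0

open Classical in
/-- The total variation distance between the joint law of the value at the root `r` and of the
values at distance at least `t` from `r`, and the product of their laws. -/
def rootCorrelation [Fintype V] [Fintype X] (G : LabeledMultigraph V C) (ψ : C → Sym2 X → ℝ≥0)
    (r : V) (t : ℕ) : ℝ :=
  (1 / 2 : ℝ) * ∑ a : X, ∑ y : (G.farSet r t → X),
    |G.jointMarginal ψ r (G.farSet r t) a y
      - G.rootMarginal ψ r a * G.marginal ψ (G.farSet r t) y|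

end

end LabeledMultigraph

/-! ### Poisson ensembles -/

/-- The data of a Poisson ensemble with alphabet `X`: a density, a collection of symmetric
nonnegative weight functions indexed by `C`, and a probability distribution on `C`. -/
structure PoissonEnsemble (X C : Type*) where
  /-- the density -/
  γ : ℝ≥0
  /-- the weight functions -/
  ψ : C → Sym2 X → ℝ≥0
  /-- the distribution of the weight function of an edge -/
  p : PMF C

/-- Lists carry the discrete σ-algebra. -/
instance listDiscreteMeasurableSpace (C : Type*) : MeasurableSpace (List C) := ⊤

noncomputable section

/-- The law of a list of `n` independent labels with law `p`. -/
def iidList {C : Type*} (p : PMF C) : ℕ → PMF (List C)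
  | 0 => PMF.pure []
  | n + 1 => p.bind fun a => (iidList p n).map (a :: ·)

/-- The law of a list of independent labels with law `p`, whose length is an independent Poisson
variable of mean `m`. -/
def poissonList {C : Type*} (m : ℝ≥0) (p : PMF C) : PMF (List C) :=
  (poissonMeasure m).toPMF.bind (iidList p)

/-- The multigraph on `[N]` in which `g e` lists the labels of the edges with end points `e`. -/
def multigraphOfLists {C : Type*} (N : ℕ) (g : Sym2 (Fin N) → List C) :
    LabeledMultigraph (Fin N) C where
  Edge := Σ e : Sym2 (Fin N), Fin (g e).length
  edgeFintype := inferInstance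
  ends := fun e => e.1
  label := fun e => (g e.1).get e.2

/-! ### Galton–Watson trees

The possible nodes are the words in `ℕ`: the empty word is the root and `i :: u` is the child
number `i` of `u`.  A family `ω` of lists describes the tree in which the edges from the node `u`
to its children have the labels `ω u`; in particular `u` has `(ω u).length` children. -/

/-- `u` is a node of the infinite tree described by `ω`. -/
def IsTreeNode {C : Type*} (ω : List ℕ → List C) : List ℕ → Prop
  | [] => True
  | i :: u => IsTreeNode ω u ∧ i < (ω u).length

/-- The nodes of depth at most `ℓ`. -/
def truncatedNodes {C : Type*} (ω : List ℕ → List C) (ℓ : ℕ) : Set (List ℕ) :=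
  {u | IsTreeNode ω u ∧ u.length ≤ ℓ}

theorem truncatedNodes_finite {C : Type*} (ω : List ℕ → List C) (ℓ : ℕ) :
    (truncatedNodes ω ℓ).Finite := by
  induction ℓ with
  | zero =>
    refine (Set.finite_singleton ([] : List ℕ)).subset ?_
    rintro u ⟨-, hu⟩
    simpa using hu
  | succ ℓ ih =>
    refine ((Set.finite_singleton ([] : List ℕ)).union
      (ih.biUnion fun u _ => (Set.finite_Iio (ω u).length).image fun i => i :: u)).subset ?_
    rintro u ⟨hu, hl⟩
    cases u with
    | nil => exact Or.inl rfl
    | cons i u =>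
      refine Or.inr (Set.mem_biUnion (x := u) ⟨hu.1, ?_⟩ ⟨i, hu.2, rfl⟩)
      simpa using hl

instance truncatedNodesFintype {C : Type*} (ω : List ℕ → List C) (ℓ : ℕ) :
    Fintype (truncatedNodes ω ℓ) :=
  (truncatedNodes_finite ω ℓ).fintype

theorem nil_mem_truncatedNodes {C : Type*} (ω : List ℕ → List C) (ℓ : ℕ) :
    [] ∈ truncatedNodes ω ℓ :=
  ⟨trivial, Nat.zero_le ℓ⟩

/-- The root of the truncated tree. -/
def treeRoot {C : Type*} (ω : List ℕ → List C) (ℓ : ℕ) : truncatedNodes ω ℓ :=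
  ⟨[], nil_mem_truncatedNodes ω ℓ⟩

theorem parent_mem_truncatedNodes {C : Type*} {ω : List ℕ → List C} {ℓ i : ℕ} {u : List ℕ}
    (h : i :: u ∈ truncatedNodes ω ℓ) : u ∈ truncatedNodes ω ℓ :=
  ⟨h.1.1, (Nat.le_succ u.length).trans h.2⟩

/-- The truncation at depth `ℓ` of the tree described by `ω`.  There is one edge for every node
`i :: u` other than the root; it joins `u` to `i :: u` and has the label number `i` in `ω u`. -/
def truncatedTree {C : Type*} (ω : List ℕ → List C) (ℓ : ℕ) :
    LabeledMultigraph (truncatedNodes ω ℓ) C where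
  Edge := {e : ℕ × truncatedNodes ω ℓ // e.1 :: e.2.1 ∈ truncatedNodes ω ℓ}
  edgeFintype := by
    have : Finite {e : ℕ × truncatedNodes ω ℓ // e.1 :: e.2.1 ∈ truncatedNodes ω ℓ} := by
      refine Finite.of_injective (β := truncatedNodes ω ℓ) (fun e => ⟨e.1.1 :: e.1.2.1, e.2⟩) ?_
      rintro ⟨⟨i, u, hu⟩, h⟩ ⟨⟨j, v, hv⟩, h'⟩ hij
      simpa using hij
    exact Fintype.ofFinite _
  ends := fun e => s(e.1.2, ⟨e.1.1 :: e.1.2.1, e.2⟩)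
  label := fun e => (ω e.1.2.1).get ⟨e.1.1, e.2.1.2⟩

/-! ### Random structures, reconstruction, two-replica types -/

/-- Given the numbers `P n`, the probabilities of the events `A n`: the sequence of events holds
with positive probability, i.e. there are `δ > 0` and infinitely many `n` with `P n ≥ δ`. -/
def WithPositiveProbability (P : ℕ → ℝ≥0∞) : Prop :=
  ∃ δ : ℝ≥0∞, 0 < δ ∧ ∃ᶠ n in atTop, δ ≤ P n

/-- The deviation `Δν(a, b) = ν(a, b) - 1 / |X|²` of the type of the two replicas `x₁`, `x₂`,
where `ν(a, b)` is the fraction of the vertices `j` with `x₁ j = a` and `x₂ j = b`. -/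
def typeDeviation {X : Type*} [Fintype X] {N : ℕ} (x₁ x₂ : Fin N → X) (a b : X) : ℝ :=
  ({j : Fin N | x₁ j = a ∧ x₂ j = b}.ncard : ℝ) / N - 1 / (Fintype.card X : ℝ) ^ 2

namespace PoissonEnsemble

variable {X C : Type*} (M : PoissonEnsemble X C)

open Classical in
/-- The law of the random multigraph on `[N]`: independently for all unordered pairs `e`, the
number of edges with end points `e` is Poisson of mean `2γ / N`, or `γ / N` for a loop, and all
edges have independent labels with law `p`. -/
def graphLaw (N : ℕ) : Measure (Sym2 (Fin N) → List C) :=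
  Measure.pi fun e => (poissonList (if e.IsDiag then M.γ / N else 2 * M.γ / N) M.p).toMeasure

/-- The joint law of the random multigraph and of an independent uniformly random root. -/
def rootedGraphLaw (N : ℕ) : Measure ((Sym2 (Fin N) → List C) × Fin N) :=
  (M.graphLaw N).prod (uniformOn Set.univ)

/-- The law of the labelled Galton–Watson tree with Poisson offspring of mean `2γ`. -/
def treeLaw : Measure (List ℕ → List C) :=
  Measure.infinitePi fun _ => (poissonList (2 * M.γ) M.p).toMeasure

variable [Fintype X]

/-- Reconstruction is solvable for the sequence of random graphical models. -/
def GraphSolvable : Prop :=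
  ∃ ε : ℝ, 0 < ε ∧ ∀ t : ℕ, WithPositiveProbability fun N =>
    M.rootedGraphLaw N {ω | ε ≤ (multigraphOfLists N ω.1).rootCorrelation M.ψ ω.2 t}

/-- Reconstruction is solvable for the sequence of truncated Galton–Watson trees. -/
def TreeSolvable : Prop :=
  ∃ ε : ℝ, 0 < ε ∧ ∀ t : ℕ, WithPositiveProbability fun ℓ =>
    M.treeLaw {ω | ε < (truncatedTree ω ℓ).rootCorrelation M.ψ (treeRoot ω ℓ) t}

/-- The probability that the partition function of the random multigraph on `[N]` is positive,
i.e. that its graphical model is defined. -/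
def probDefined (N : ℕ) : ℝ≥0∞ :=
  M.graphLaw N {g | 0 < (multigraphOfLists N g).partitionFunction M.ψ}

open Classical in
/-- The expectation, over the random multigraph on `[N]` and, given it, over two independent
replicas, of the square of `Δν(a, a) - (2 / |X|) ∑_b Δν(a, b)`. -/
def typeSecondMoment (N : ℕ) (a : X) : ℝ :=
  ∫ g, ∑ x₁ : Fin N → X, ∑ x₂ : Fin N → X,
    (multigraphOfLists N g).gibbs M.ψ x₁ * (multigraphOfLists N g).gibbs M.ψ x₂ *
      (typeDeviation x₁ x₂ a a
        - 2 / (Fintype.card X : ℝ) * ∑ b : X, typeDeviation x₁ x₂ a b) ^ 2 ∂(M.graphLaw N)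

end PoissonEnsemble

end

/-!
Around a uniform root the sparse random multigraph is a planted copy of the truncated
Galton–Watson tree: for a fixed tree with `E` edges, each of the about `N ^ (E + 1)` injective
maps of its nodes into `[N]` plants it with probability about `N ^ (-E)` times the probability of
the tree, and such a planting is independent of the edges which do not meet the inner nodes.
Maps which increase along siblings represent every planting of a labelled tree exactly once.

Given the planting, the rest of the graph acts on the tree only through the joint law of the values
at the planted nodes. If this law is nearly uniform, the correlation between the root and the far
vertices is nearly the one in the isolated tree.

At most places it is nearly uniform. The second moment of the type defect of two replicas bounds
the overlap of the centred indicators of `x_j = a`, hence the fluctuations of the empirical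
frequency of `a`, hence those of `ν(a, a)`. Averaged over all `k`-tuples of vertices, the squared
distance of the joint law from the uniform one is a combination of moments of these frequencies,
and Chebyshev's inequality bounds the fraction of bad tuples. Deleting the edges at the planted
nodes only costs a constant factor, so the bad tuples also remain negligible after a planting.
-/

section WeightedSums

theorem norm_prod_sub_prod_le_sum {ι R : Type*} [NormedCommRing R] [NormOneClass R]
    (s : Finset ι) {a b : ι → R} (ha : ∀ i, ‖a i‖ ≤ 1) (hb : ∀ i, ‖b i‖ ≤ 1) :
    ‖∏ i ∈ s, a i - ∏ i ∈ s, b i‖ ≤ ∑ i ∈ s, ‖a i - b i‖ := by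
  classical
  induction s using Finset.induction_on with
  | empty => simp
  | insert j s hj ih =>
    rw [Finset.prod_insert hj, Finset.prod_insert hj, Finset.sum_insert hj]
    have hprod : ‖∏ i ∈ s, a i‖ ≤ 1 :=
      (s.norm_prod_le a).trans (Finset.prod_le_one (fun _ _ => norm_nonneg _) fun i _ => ha i)
    calc ‖a j * ∏ i ∈ s, a i - b j * ∏ i ∈ s, b i‖
        = ‖(a j - b j) * ∏ i ∈ s, a i + b j * (∏ i ∈ s, a i - ∏ i ∈ s, b i)‖ := by
          congr 1; ring
      _ ≤ ‖a j - b j‖ * ‖∏ i ∈ s, a i‖ + ‖b j‖ * ‖∏ i ∈ s, a i - ∏ i ∈ s, b i‖ :=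
          (norm_add_le _ _).trans (add_le_add (norm_mul_le _ _) (norm_mul_le _ _))
      _ ≤ ‖a j - b j‖ * 1 + 1 * ∑ i ∈ s, ‖a i - b i‖ := by gcongr; exact hb j
      _ = ‖a j - b j‖ + ∑ i ∈ s, ‖a i - b i‖ := by rw [mul_one, one_mul]

variable {Ω : Type*} [Fintype Ω]

theorem sum_mul_abs_le_sqrt {p : Ω → ℝ} (hp : ∀ ω, 0 ≤ p ω) (hp₁ : ∑ ω, p ω = 1) (f : Ω → ℝ) :
    ∑ ω, p ω * |f ω| ≤ √(∑ ω, p ω * f ω ^ 2) := by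
  refine Real.le_sqrt_of_sq_le ?_
  simpa only [sq_abs] using Real.pow_arith_mean_le_arith_mean_pow Finset.univ p (fun ω => |f ω|)
    (fun ω _ => hp ω) hp₁ (fun ω _ => abs_nonneg _) 2

-- Both sides are quadratic in the matrix of second moments of `φ`: on the left stands the square
-- of the sum of its entries, on the right the sum of their squares.
theorem sq_sum_mul_sq_sum_le {V : Type*} [Fintype V] (p : Ω → ℝ) (φ : Ω → V → ℝ) :
    (∑ ω, p ω * (∑ v, φ ω v) ^ 2) ^ 2
      ≤ (Fintype.card V : ℝ) ^ 2 * ∑ ω₁, ∑ ω₂, p ω₁ * p ω₂ * (∑ v, φ ω₁ v * φ ω₂ v) ^ 2 := by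
  let K : V × V → ℝ := fun z => ∑ ω, p ω * (φ ω z.1 * φ ω z.2)
  have hsum : ∑ ω, p ω * (∑ v, φ ω v) ^ 2 = ∑ z, K z := by
    have hsq (ω : Ω) : p ω * (∑ v, φ ω v) ^ 2 = ∑ z : V × V, p ω * (φ ω z.1 * φ ω z.2) := by
      rw [← Finset.mul_sum, sq, Finset.sum_mul_sum, Fintype.sum_prod_type]
    simp only [hsq]
    exact Finset.sum_comm
  have hsq : ∑ ω₁, ∑ ω₂, p ω₁ * p ω₂ * (∑ v, φ ω₁ v * φ ω₂ v) ^ 2 = ∑ z, K z ^ 2 := by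
    have hpair (ω₁ ω₂ : Ω) : p ω₁ * p ω₂ * (∑ v, φ ω₁ v * φ ω₂ v) ^ 2
        = ∑ z : V × V, p ω₁ * (φ ω₁ z.1 * φ ω₁ z.2) * (p ω₂ * (φ ω₂ z.1 * φ ω₂ z.2)) := by
      rw [sq, Finset.sum_mul_sum, ← Fintype.sum_prod_type', Finset.mul_sum]
      exact Finset.sum_congr rfl fun z _ => by ring
    simp only [hpair]
    simp only [K, sq, Finset.sum_mul_sum]
    rw [Finset.sum_comm_cycle, Finset.sum_comm_cycle]
  rw [hsum, hsq]
  simpa [sq] using sq_sum_le_card_mul_sum_sq (s := Finset.univ) (f := K)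

theorem abs_sum_mul_prod_sub_pow_le {T : Type*} [Fintype T] {p : Ω → ℝ} (hp : ∀ ω, 0 ≤ p ω)
    {f : Ω → T → ℝ} (hf : ∀ ω u, ‖f ω u‖ ≤ 1) {c : ℝ} (hc : ‖c‖ ≤ 1) :
    |∑ ω, p ω * (∏ u, f ω u - c ^ Fintype.card T)| ≤ ∑ u, ∑ ω, p ω * |f ω u - c| := by
  calc |∑ ω, p ω * (∏ u, f ω u - c ^ Fintype.card T)|
      ≤ ∑ ω, p ω * |∏ u, f ω u - c ^ Fintype.card T| := by
        refine (Finset.abs_sum_le_sum_abs _ _).trans_eq (Finset.sum_congr rfl fun ω _ => ?_)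
        rw [abs_mul, abs_of_nonneg (hp ω)]
    _ ≤ ∑ ω, p ω * ∑ u, |f ω u - c| := by
        refine Finset.sum_le_sum fun ω _ => mul_le_mul_of_nonneg_left ?_ (hp ω)
        simpa using norm_prod_sub_prod_le_sum Finset.univ (hf ω) fun _ => hc
    _ = ∑ u, ∑ ω, p ω * |f ω u - c| := by
        simp only [Finset.mul_sum]
        exact Finset.sum_comm

end WeightedSums

section Frequency

variable {V T X Y : Type*} [Fintype V]

/-- The fraction of the sites with value `a`.  For a pair `Function.prod x₁ x₂` of replicas and the
value `(a, b)` it is the entry `ν(a, b)` of their joint type. -/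
noncomputable def frequency (x : V → Y) (a : Y) : ℝ :=
  ({v | x v = a}.ncard : ℝ) / Fintype.card V

theorem frequency_eq_sum [DecidableEq Y] (x : V → Y) (a : Y) :
    frequency x a = (∑ v, if x v = a then 1 else 0) / Fintype.card V := by
  rw [frequency, Set.ncard_eq_toFinset_card', Finset.sum_boole, Set.toFinset_ofPred]

theorem frequency_nonneg (x : V → Y) (a : Y) : 0 ≤ frequency x a := by
  unfold frequency
  positivity

theorem frequency_le_one (x : V → Y) (a : Y) : frequency x a ≤ 1 := by
  refine div_le_one_of_le₀ ?_ (Nat.cast_nonneg _)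
  exact_mod_cast (Set.ncard_le_card _).trans_eq Nat.card_eq_fintype_card

theorem norm_frequency_le_one (x : V → Y) (a : Y) : ‖frequency x a‖ ≤ 1 := by
  rw [Real.norm_of_nonneg (frequency_nonneg x a)]
  exact frequency_le_one x a

theorem sum_frequency_pair [Fintype Y] (x₁ : V → X) (x₂ : V → Y) (a : X) :
    ∑ b, frequency (Function.prod x₁ x₂) (a, b) = frequency x₁ a := by
  classical
  simp only [frequency_eq_sum, ← Finset.sum_div, Function.prod_apply, Prod.mk.injEq]
  rw [Finset.sum_comm]
  congr 1
  refine Finset.sum_congr rfl fun v _ => ?_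
  by_cases h : x₁ v = a <;> simp [h]

theorem prod_frequency [Fintype T] [DecidableEq T] [DecidableEq Y] (x : V → Y) (ξ : T → Y) :
    ∏ u, frequency x (ξ u)
      = (∑ j : T → V, if x ∘ j = ξ then 1 else 0) / (Fintype.card V : ℝ) ^ Fintype.card T := by
  simp only [frequency_eq_sum, Finset.prod_div_distrib, Finset.prod_const, Finset.card_univ,
    Finset.prod_univ_sum, Fintype.piFinset_univ, Fintype.prod_boole, funext_iff,
    Function.comp_apply]

end Frequency

section LocalMarginal

variable {V T X : Type*} [Fintype V] [DecidableEq V] [Fintype X]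

open Classical in
/-- The total weight `p` of the configurations with the values `ξ` at the sites `j`; if `p` is a
probability, this is the joint law of the values at these sites. -/
noncomputable def localMarginal (p : (V → X) → ℝ) (j : T → V) (ξ : T → X) : ℝ :=
  ∑ x, if x ∘ j = ξ then p x else 0

variable [Fintype T] [DecidableEq T]

theorem average_localMarginal (p : (V → X) → ℝ) (ξ : T → X) :
    (∑ j : T → V, localMarginal p j ξ) / (Fintype.card V : ℝ) ^ Fintype.card T
      = ∑ x, p x * ∏ u, frequency x (ξ u) := by
  classical
  simp only [prod_frequency, localMarginal, mul_div_assoc', Finset.mul_sum, mul_ite, mul_one,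
    mul_zero, ← Finset.sum_div]
  rw [Finset.sum_comm]
  congr!

theorem average_localMarginal_sq (p : (V → X) → ℝ) (ξ : T → X) :
    (∑ j : T → V, localMarginal p j ξ ^ 2) / (Fintype.card V : ℝ) ^ Fintype.card T
      = ∑ x₁, ∑ x₂, p x₁ * p x₂ * ∏ u, frequency (Function.prod x₁ x₂) (ξ u, ξ u) := by
  classical
  have hpair (x₁ x₂ : V → X) (j : T → V) :
      Function.prod x₁ x₂ ∘ j = (fun u => (ξ u, ξ u)) ↔ x₁ ∘ j = ξ ∧ x₂ ∘ j = ξ := by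
    simp only [funext_iff, Function.comp_apply, Function.prod_apply, Prod.mk.injEq, forall_and]
  have hsq (j : T → V) : localMarginal p j ξ ^ 2
      = ∑ x₁, ∑ x₂, if x₁ ∘ j = ξ ∧ x₂ ∘ j = ξ then p x₁ * p x₂ else 0 := by
    rw [localMarginal, sq, Finset.sum_mul_sum]
    simp only [ite_zero_mul_ite_zero]
    congr!
  have hfreq (x₁ x₂ : V → X) := prod_frequency (Function.prod x₁ x₂) fun u => (ξ u, ξ u)
  simp only [hfreq, hpair, hsq, mul_div_assoc', Finset.mul_sum, mul_ite, mul_one, mul_zero,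
    ← Finset.sum_div]
  rw [Finset.sum_comm]
  congr 1
  refine Finset.sum_congr rfl fun x₁ _ => Finset.sum_comm

theorem average_localMarginal_sub_sq [Nonempty V] {p : (V → X) → ℝ} (hp₁ : ∑ x, p x = 1)
    (ξ : T → X) (b : ℝ) :
    (∑ j : T → V, (localMarginal p j ξ - b) ^ 2) / (Fintype.card V : ℝ) ^ Fintype.card T
      = ∑ x₁, ∑ x₂, p x₁ * p x₂ * (∏ u, frequency (Function.prod x₁ x₂) (ξ u, ξ u) - b ^ 2)
        - 2 * b * ∑ x, p x * (∏ u, frequency x (ξ u) - b) := by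
  have hcard : (∑ _j : T → V, (1 : ℝ)) / (Fintype.card V : ℝ) ^ Fintype.card T = 1 := by simp
  have hexpand (j : T → V) : (localMarginal p j ξ - b) ^ 2
      = localMarginal p j ξ ^ 2 - 2 * b * localMarginal p j ξ + b ^ 2 * 1 := by ring
  simp only [hexpand, Finset.sum_add_distrib, Finset.sum_sub_distrib, ← Finset.mul_sum, add_div,
    sub_div, mul_div_assoc, average_localMarginal, average_localMarginal_sq, hcard, mul_sub,
    ← Finset.sum_mul, hp₁]
  ring

end LocalMarginal

section TypeDefect

variable {N : ℕ} {X : Type*} [Fintype X]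

/-- The combination `Δν(a, a) - (2 / |X|) ∑_b Δν(a, b)` of type deviations whose second moment the
hypothesis of the theorem controls. -/
noncomputable def typeDefect (x₁ x₂ : Fin N → X) (a : X) : ℝ :=
  typeDeviation x₁ x₂ a a - 2 / (Fintype.card X : ℝ) * ∑ b : X, typeDeviation x₁ x₂ a b

theorem typeDeviation_eq (x₁ x₂ : Fin N → X) (a b : X) :
    typeDeviation x₁ x₂ a b
      = frequency (Function.prod x₁ x₂) (a, b) - ((Fintype.card X : ℝ)⁻¹) ^ 2 := by
  simp [typeDeviation, frequency, Function.prod_apply]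

theorem typeDefect_eq [Nonempty X] (x₁ x₂ : Fin N → X) (a : X) :
    typeDefect x₁ x₂ a = frequency (Function.prod x₁ x₂) (a, a) - ((Fintype.card X : ℝ)⁻¹) ^ 2
      - 2 * (Fintype.card X : ℝ)⁻¹ * (frequency x₁ a - (Fintype.card X : ℝ)⁻¹) := by
  simp only [typeDefect, typeDeviation_eq, Finset.sum_sub_distrib, sum_frequency_pair,
    Finset.sum_const, Finset.card_univ, nsmul_eq_mul]
  field_simp

open Classical in
theorem average_centered_mul_centered [Nonempty X] [NeZero N] (x₁ x₂ : Fin N → X) (a : X) :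
    (∑ v, ((if x₁ v = a then 1 else 0) - (Fintype.card X : ℝ)⁻¹)
        * ((if x₂ v = a then 1 else 0) - (Fintype.card X : ℝ)⁻¹)) / N
      = (typeDefect x₁ x₂ a + typeDefect x₂ x₁ a) / 2 := by
  have hN : (N : ℝ) ≠ 0 := NeZero.ne _
  simp only [typeDefect_eq, frequency_eq_sum, Function.prod_apply, Prod.mk.injEq, sub_mul, mul_sub,
    ite_zero_mul_ite_zero, and_comm (a := x₂ _ = a), Finset.sum_sub_distrib, ← Finset.sum_mul,
    ← Finset.mul_sum, mul_one, Finset.sum_const, Finset.card_univ, nsmul_eq_mul, Fintype.card_fin]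
  field_simp
  ring

/-- The second moment of the type defect of two independent replicas of law `p`. -/
noncomputable def defectSecondMoment (p : (Fin N → X) → ℝ) (a : X) : ℝ :=
  ∑ x₁, ∑ x₂, p x₁ * p x₂ * typeDefect x₁ x₂ a ^ 2

variable {p : (Fin N → X) → ℝ} (hp : ∀ x, 0 ≤ p x)
include hp

theorem sum_mul_sq_symmetrized_le (a : X) :
    ∑ x₁, ∑ x₂, p x₁ * p x₂ * ((typeDefect x₁ x₂ a + typeDefect x₂ x₁ a) / 2) ^ 2
      ≤ defectSecondMoment p a := by
  have hswap : ∑ x₁, ∑ x₂, p x₁ * p x₂ * typeDefect x₂ x₁ a ^ 2 = defectSecondMoment p a := by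
    rw [Finset.sum_comm]
    simp only [mul_comm (p _) (p _)]
    rfl
  calc ∑ x₁, ∑ x₂, p x₁ * p x₂ * ((typeDefect x₁ x₂ a + typeDefect x₂ x₁ a) / 2) ^ 2
      ≤ ∑ x₁, ∑ x₂, (p x₁ * p x₂ * typeDefect x₁ x₂ a ^ 2
          + p x₁ * p x₂ * typeDefect x₂ x₁ a ^ 2) / 2 := by
        refine Finset.sum_le_sum fun x₁ _ => Finset.sum_le_sum fun x₂ _ => ?_
        rw [← mul_add, mul_div_assoc]
        refine mul_le_mul_of_nonneg_left ?_ (mul_nonneg (hp _) (hp _))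
        linarith [sq_nonneg (typeDefect x₁ x₂ a - typeDefect x₂ x₁ a)]
    _ = defectSecondMoment p a := by
        simp only [← Finset.sum_div, Finset.sum_add_distrib, hswap]
        rw [← defectSecondMoment, add_self_div_two]

theorem sum_mul_abs_typeDefect_le (hp₁ : ∑ x, p x = 1) (a : X) :
    ∑ x₁, ∑ x₂, p x₁ * p x₂ * |typeDefect x₁ x₂ a| ≤ √(defectSecondMoment p a) := by
  have h := sum_mul_abs_le_sqrt (p := fun z : (Fin N → X) × (Fin N → X) => p z.1 * p z.2)
    (fun z => mul_nonneg (hp z.1) (hp z.2))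
    (by rw [Fintype.sum_prod_type, ← Finset.sum_mul_sum, hp₁, mul_one])
    fun z => typeDefect z.1 z.2 a
  rwa [Fintype.sum_prod_type, Fintype.sum_prod_type] at h

variable [Nonempty X] [NeZero N]

theorem sum_mul_sq_frequency_sub_le (a : X) :
    ∑ x, p x * (frequency x a - (Fintype.card X : ℝ)⁻¹) ^ 2 ≤ √(defectSecondMoment p a) := by
  classical
  have hN : (N : ℝ) ≠ 0 := NeZero.ne _
  let φ : (Fin N → X) → Fin N → ℝ := fun x v =>
    (if x v = a then 1 else 0) - (Fintype.card X : ℝ)⁻¹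
  have hfrequency (x : Fin N → X) :
      frequency x a - (Fintype.card X : ℝ)⁻¹ = (∑ v, φ x v) / N := by
    simp only [frequency_eq_sum, φ, Finset.sum_sub_distrib, Finset.sum_const, Finset.card_univ,
      Fintype.card_fin, nsmul_eq_mul]
    field_simp
  refine Real.le_sqrt_of_sq_le (le_trans ?_ (sum_mul_sq_symmetrized_le hp a))
  have hoverlap := sq_sum_mul_sq_sum_le p φ
  simp only [hfrequency, ← average_centered_mul_centered, div_pow, mul_div_assoc',
    ← Finset.sum_div, Fintype.card_fin] at hoverlap ⊢
  rw [div_le_div_iff₀ (by positivity) (by positivity)]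
  nlinarith [sq_nonneg (N : ℝ)]

variable (hp₁ : ∑ x, p x = 1)
include hp₁

theorem sum_mul_abs_frequency_sub_le (a : X) :
    ∑ x, p x * |frequency x a - (Fintype.card X : ℝ)⁻¹| ≤ √√(defectSecondMoment p a) :=
  (sum_mul_abs_le_sqrt hp hp₁ _).trans (Real.sqrt_le_sqrt (sum_mul_sq_frequency_sub_le hp a))

theorem sum_mul_abs_frequency_pair_sub_le (a : X) :
    ∑ x₁, ∑ x₂, p x₁ * p x₂
        * |frequency (Function.prod x₁ x₂) (a, a) - ((Fintype.card X : ℝ)⁻¹) ^ 2|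
      ≤ √(defectSecondMoment p a) + 2 * √√(defectSecondMoment p a) := by
  set c := (Fintype.card X : ℝ)⁻¹
  have hc : |2 * c| ≤ 2 := by
    rw [abs_of_nonneg (by positivity)]
    linarith [Nat.cast_inv_le_one (α := ℝ) (Fintype.card X)]
  have habs (x₁ x₂ : Fin N → X) : |frequency (Function.prod x₁ x₂) (a, a) - c ^ 2|
      ≤ |typeDefect x₁ x₂ a| + 2 * |frequency x₁ a - c| := by
    rw [show frequency (Function.prod x₁ x₂) (a, a) - c ^ 2
        = typeDefect x₁ x₂ a + 2 * c * (frequency x₁ a - c) by rw [typeDefect_eq]; ring]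
    refine (abs_add_le _ _).trans ?_
    rw [abs_mul]
    gcongr
  calc ∑ x₁, ∑ x₂, p x₁ * p x₂ * |frequency (Function.prod x₁ x₂) (a, a) - c ^ 2|
      ≤ ∑ x₁, ∑ x₂, p x₁ * p x₂ * (|typeDefect x₁ x₂ a| + 2 * |frequency x₁ a - c|) :=
        Finset.sum_le_sum fun x₁ _ => Finset.sum_le_sum fun x₂ _ =>
          mul_le_mul_of_nonneg_left (habs x₁ x₂) (mul_nonneg (hp x₁) (hp x₂))
    _ = ∑ x₁, ∑ x₂, p x₁ * p x₂ * |typeDefect x₁ x₂ a|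
          + 2 * ∑ x, p x * |frequency x a - c| := by
        have hexpand (x₁ x₂ : Fin N → X) :
            p x₁ * p x₂ * (|typeDefect x₁ x₂ a| + 2 * |frequency x₁ a - c|)
              = p x₁ * p x₂ * |typeDefect x₁ x₂ a|
                + 2 * (p x₁ * |frequency x₁ a - c| * p x₂) := by ring
        simp only [hexpand, Finset.sum_add_distrib, ← Finset.mul_sum, hp₁, mul_one]
    _ ≤ √(defectSecondMoment p a) + 2 * √√(defectSecondMoment p a) := by
        gcongr
        · exact sum_mul_abs_typeDefect_le hp hp₁ a
        · exact sum_mul_abs_frequency_sub_le hp hp₁ a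

theorem average_localMarginal_sub_pow_sq_le {T : Type*} [Fintype T] [DecidableEq T] (ξ : T → X) :
    (∑ j : T → Fin N,
        (localMarginal p j ξ - ((Fintype.card X : ℝ)⁻¹) ^ Fintype.card T) ^ 2)
          / (N : ℝ) ^ Fintype.card T
      ≤ ∑ u, (√(defectSecondMoment p (ξ u)) + 4 * √√(defectSecondMoment p (ξ u))) := by
  set c := (Fintype.card X : ℝ)⁻¹
  have hc : ‖c‖ ≤ 1 := by
    rw [Real.norm_of_nonneg (by positivity)]
    exact Nat.cast_inv_le_one _
  have hc₂ : ‖c ^ 2‖ ≤ 1 := norm_pow c 2 ▸ pow_le_one₀ (norm_nonneg c) hc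
  have hpow : |c ^ Fintype.card T| ≤ 1 := abs_pow c _ ▸ pow_le_one₀ (abs_nonneg c) hc
  have hone : |∑ x, p x * (∏ u, frequency x (ξ u) - c ^ Fintype.card T)|
      ≤ ∑ u, √√(defectSecondMoment p (ξ u)) :=
    (abs_sum_mul_prod_sub_pow_le hp (fun x u => norm_frequency_le_one x (ξ u)) hc).trans
      (Finset.sum_le_sum fun u _ => sum_mul_abs_frequency_sub_le hp hp₁ (ξ u))
  have htwo : |∑ x₁, ∑ x₂, p x₁ * p x₂
        * (∏ u, frequency (Function.prod x₁ x₂) (ξ u, ξ u) - (c ^ Fintype.card T) ^ 2)|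
      ≤ ∑ u, (√(defectSecondMoment p (ξ u)) + 2 * √√(defectSecondMoment p (ξ u))) := by
    have h := abs_sum_mul_prod_sub_pow_le (T := T)
      (p := fun z : (Fin N → X) × (Fin N → X) => p z.1 * p z.2)
      (fun z => mul_nonneg (hp z.1) (hp z.2))
      (fun z u => norm_frequency_le_one (Function.prod z.1 z.2) (ξ u, ξ u)) hc₂
    simp only [Fintype.sum_prod_type, pow_right_comm c 2] at h
    exact h.trans
      (Finset.sum_le_sum fun u _ => sum_mul_abs_frequency_pair_sub_le hp hp₁ (ξ u))
  have hexpand := average_localMarginal_sub_sq hp₁ ξ (c ^ Fintype.card T)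
  rw [Fintype.card_fin] at hexpand
  rw [hexpand]
  set S := ∑ x, p x * (∏ u, frequency x (ξ u) - c ^ Fintype.card T)
  have hcross : -(2 * c ^ Fintype.card T * S) ≤ 2 * ∑ u, √√(defectSecondMoment p (ξ u)) := by
    refine (neg_le_abs _).trans ?_
    rw [abs_mul, abs_mul, abs_two, mul_assoc]
    gcongr
    exact (mul_le_of_le_one_left (abs_nonneg S) hpow).trans hone
  refine (add_le_add ((le_abs_self _).trans htwo) hcross).trans_eq ?_
  rw [Finset.mul_sum, ← Finset.sum_add_distrib]
  exact Finset.sum_congr rfl fun u _ => by ring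

end TypeDefect

section LocalMarginal

variable {V T S X : Type*} [Fintype V] [DecidableEq V] [Fintype X]

theorem localMarginal_comp_mul (j : T → V) (b : (T → X) → ℝ) (p : (V → X) → ℝ) (ξ : T → X) :
    localMarginal (fun x => b (x ∘ j) * p x) j ξ = b ξ * localMarginal p j ξ := by
  simp only [localMarginal, Finset.mul_sum, mul_ite, mul_zero]
  exact Finset.sum_congr rfl fun x _ => by split_ifs with h <;> simp [h]

theorem continuous_localMarginal (j : T → V) (ξ : T → X) :
    Continuous fun p : (V → X) → ℝ => localMarginal p j ξ :=
  continuous_finsetSum _ fun x _ => by split_ifs <;> fun_prop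

theorem localMarginal_eq_sum_filter (p : (V → X) → ℝ) (j : T → V) (ξ : T → X)
    [DecidablePred fun x : V → X => x ∘ j = ξ] :
    localMarginal p j ξ = ∑ x with x ∘ j = ξ, p x := by
  rw [localMarginal, Finset.sum_filter]
  congr!

variable [Fintype T] [DecidableEq T]

theorem sum_localMarginal (p : (V → X) → ℝ) (j : T → V) :
    ∑ ξ, localMarginal p j ξ = ∑ x, p x := by
  simp only [localMarginal]
  rw [Finset.sum_comm]
  refine Finset.sum_congr rfl fun x _ => ?_
  rw [Fintype.sum_eq_single (x ∘ j) fun ξ h => if_neg h.symm, if_pos rfl]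

theorem localMarginal_comp (p : (V → X) → ℝ) (j : T → V) (k : S → T) (η : S → X) :
    localMarginal p (j ∘ k) η = localMarginal (localMarginal p j) k η := by
  classical
  have h := sum_localMarginal (fun x => (if (x ∘ j) ∘ k = η then 1 else 0) * p x) j
  simp only [localMarginal_comp_mul j (fun ξ => if ξ ∘ k = η then 1 else 0)] at h
  simp only [ite_mul, one_mul, zero_mul] at h
  exact h.symm

-- A configuration on `V` is glued from its restriction to `F` and its pullback along `ι`, which
-- only have to agree on `ι ⁻¹' F`.
theorem localMarginal_comp_subtypeVal {ι : T → V} (hι : ι.Injective) {F : Set V}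
    (hF : Fᶜ ⊆ Set.range ι) (f : (T → X) → ℝ) (y : F → X) :
    localMarginal (fun x => f (x ∘ ι)) ((↑) : F → V) y
      = localMarginal f ((↑) : ι ⁻¹' F → T) (y ∘ F.restrictPreimage ι) := by
  classical
  rw [localMarginal_eq_sum_filter, localMarginal_eq_sum_filter]
  refine Finset.sum_nbij (· ∘ ι) ?_ ?_ ?_ fun _ _ => rfl
  · intro x hx
    simp only [Finset.mem_filter, Finset.mem_univ, true_and] at hx ⊢
    rw [← hx]
    rfl
  · intro x hx x' hx' h
    simp only [Finset.coe_filter, Finset.mem_univ, true_and, Set.mem_ofPred_eq] at hx hx'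
    funext v
    by_cases hv : v ∈ F
    · exact congrFun (hx.trans hx'.symm) ⟨v, hv⟩
    · obtain ⟨u, rfl⟩ := hF hv
      exact congrFun h u
  · intro ξ hξ
    simp only [Finset.coe_filter, Finset.mem_univ, true_and, Set.mem_ofPred_eq] at hξ
    refine ⟨fun v => if hv : v ∈ F then y ⟨v, hv⟩ else ξ (hF hv).choose, ?_, ?_⟩
    · simp only [Finset.coe_filter, Finset.mem_univ, true_and, Set.mem_ofPred_eq]
      funext v
      simp [v.2]
    · funext u
      by_cases hu : ι u ∈ F
      · simpa [hu] using (congrFun hξ ⟨u, hu⟩).symm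
      · simpa [hu] using congrArg ξ (hι (hF hu).choose_spec)

end LocalMarginal

section Correlation

variable {V T X : Type*} [Fintype V] [DecidableEq V] [Fintype T] [DecidableEq T] [Fintype X]

open Classical in
/-- The total weight `π` of the configurations with the value `a` at `r`. -/
noncomputable def siteMarginal (r : V) (π : (V → X) → ℝ) (a : X) : ℝ :=
  ∑ x, (if x r = a then 1 else 0) * π x

open Classical in
/-- The total variation distance between the joint law of the value at `r` and of the values in
`F`, and the product of their laws, when the configurations have law `π`; it is
`LabeledMultigraph.rootCorrelation` for an arbitrary law and an arbitrary set. -/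
noncomputable def siteCorrelation (r : V) (F : Set V) (π : (V → X) → ℝ) : ℝ :=
  (1 / 2 : ℝ) * ∑ a : X, ∑ y : F → X, |localMarginal
    (fun x => ((if x r = a then 1 else 0) - siteMarginal r π a) * π x) ((↑) : F → V) y|

theorem continuous_siteCorrelation (r : V) (F : Set V) :
    Continuous fun π : (V → X) → ℝ => siteCorrelation r F π := by
  unfold siteCorrelation siteMarginal
  refine continuous_const.mul (continuous_finsetSum _ fun a _ => continuous_finsetSum _
    fun y _ => ((continuous_localMarginal _ y).comp ?_).abs)
  fun_prop

theorem siteMarginal_comp_mul (ι : T → V) (w : (T → X) → ℝ) (W : (V → X) → ℝ) (r : T) (a : X) :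
    siteMarginal (ι r) (fun x => w (x ∘ ι) * W x) a
      = siteMarginal r (fun ξ => w ξ * localMarginal W ι ξ) a := by
  classical
  have h := sum_localMarginal
    (fun x => ((if (x ∘ ι) r = a then 1 else 0) * w (x ∘ ι)) * W x) ι
  simp only [localMarginal_comp_mul ι (fun ξ => (if ξ r = a then 1 else 0) * w ξ)] at h
  simpa only [siteMarginal, mul_assoc, Function.comp_apply] using h.symm

theorem sum_abs_localMarginal_mul_comp {S U : Type*} [Fintype S] [DecidableEq S] [Fintype U]
    [DecidableEq U] {W : (S → X) → ℝ} (hW : ∀ y, 0 ≤ W y) (k : U → S) (b : (U → X) → ℝ) :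
    ∑ η, |localMarginal (fun y => W y * b (y ∘ k)) k η| = ∑ y, |W y * b (y ∘ k)| := by
  have hnonneg (η : U → X) : 0 ≤ localMarginal W k η :=
    Finset.sum_nonneg fun y _ => by split_ifs <;> simp [hW]
  simp only [mul_comm (W _) (b _), localMarginal_comp_mul k b, abs_mul, abs_of_nonneg (hW _),
    abs_of_nonneg (hnonneg _)]
  simp only [← localMarginal_comp_mul k fun η => |b η|]
  exact sum_localMarginal _ k

theorem siteCorrelation_comp_mul {ι : T → V} (hι : ι.Injective) {F : Set V}
    (hF : Fᶜ ⊆ Set.range ι) (w : (T → X) → ℝ) {W : (V → X) → ℝ} (hW : ∀ x, 0 ≤ W x)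
    (hWF : W.FactorsThrough F.domRestrict) (r : T) :
    siteCorrelation (ι r) F (fun x => w (x ∘ ι) * W x)
      = siteCorrelation r (ι ⁻¹' F) (fun ξ => w ξ * localMarginal W ι ξ) := by
  classical
  obtain ⟨W₀, hW₀⟩ := (Function.factorsThrough_iff W).1 hWF
  have hWabs (x : V → X) : W x = |W₀ (x ∘ (↑))| := by
    rw [← abs_of_nonneg (hW x), hW₀]
    rfl
  simp only [siteCorrelation, siteMarginal_comp_mul]
  congr 1
  refine Finset.sum_congr rfl fun a _ => ?_
  set R := siteMarginal r (fun ξ => w ξ * localMarginal W ι ξ) a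
  let b : (T → X) → ℝ := fun ξ => ((if ξ r = a then 1 else 0) - R) * w ξ
  let k := F.restrictPreimage ι
  have hF (y : F → X) : localMarginal (fun x => b (x ∘ ι) * W x) ((↑) : F → V) y
      = |W₀ y| * localMarginal b ((↑) : ι ⁻¹' F → T) (y ∘ k) := by
    simp only [hWabs, mul_comm (b _)]
    rw [localMarginal_comp_mul _ (fun y => |W₀ y|), localMarginal_comp_subtypeVal hι hF]
  have hT (η : ι ⁻¹' F → X) :
      localMarginal (fun ξ => b ξ * localMarginal W ι ξ) ((↑) : ι ⁻¹' F → T) η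
        = localMarginal (fun y => |W₀ y| * localMarginal b ((↑) : ι ⁻¹' F → T) (y ∘ k)) k η := by
    simp only [← hF, ← localMarginal_comp_mul ι b, ← localMarginal_comp]
    rfl
  have hsum := sum_abs_localMarginal_mul_comp (fun y => abs_nonneg (W₀ y)) k
    (localMarginal b ((↑) : ι ⁻¹' F → T))
  simp only [← hT] at hsum
  simp only [← hF, b, mul_assoc, Function.comp_apply] at hsum
  exact hsum.symm

end Correlation

section Normalized

variable {Ω : Type*} [Fintype Ω]

/-- The probability weights proportional to `f`; the zero function if the total weight of `f`
vanishes. -/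
noncomputable def normalized (f : Ω → ℝ) (ω : Ω) : ℝ :=
  f ω / ∑ ω', f ω'

theorem normalized_mul_const (f : Ω → ℝ) {c : ℝ} (hc : c ≠ 0) :
    normalized (fun ω => f ω * c) = normalized f := by
  funext ω
  rw [normalized, ← Finset.sum_mul, mul_div_mul_right _ _ hc, normalized]

variable {V T X : Type*} [Fintype V] [DecidableEq V] [Fintype X]

theorem localMarginal_normalized (f : (V → X) → ℝ) (j : T → V) (ξ : T → X) :
    localMarginal (normalized f) j ξ = localMarginal f j ξ * (∑ x, f x)⁻¹ := by
  simp only [localMarginal, normalized, Finset.sum_mul, ite_mul, zero_mul, div_eq_mul_inv]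

variable [Fintype T] [DecidableEq T]

theorem siteCorrelation_normalized_comp_mul {ι : T → V} (hι : ι.Injective) {F : Set V}
    (hF : Fᶜ ⊆ Set.range ι) (w : (T → X) → ℝ) {W : (V → X) → ℝ}
    (hW : ∀ x, 0 ≤ W x) (hW₀ : ∑ x, W x ≠ 0) (hWF : W.FactorsThrough F.domRestrict) (r : T) :
    siteCorrelation (ι r) F (normalized fun x => w (x ∘ ι) * W x)
      = siteCorrelation r (ι ⁻¹' F)
          (normalized fun ξ => w ξ * localMarginal (normalized W) ι ξ) := by
  have htotal : ∑ x, w (x ∘ ι) * W x = ∑ ξ, w ξ * localMarginal W ι ξ := by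
    rw [← sum_localMarginal _ ι]
    simp only [localMarginal_comp_mul]
  simp only [localMarginal_normalized, ← mul_assoc]
  rw [normalized_mul_const _ (inv_ne_zero hW₀)]
  set Z := ∑ x, w (x ∘ ι) * W x
  have hV : (normalized fun x => w (x ∘ ι) * W x)
      = fun x => (fun ξ => w ξ / Z) (x ∘ ι) * W x := by
    funext x
    exact div_mul_eq_mul_div _ _ _ |>.symm
  have hT : (normalized fun ξ => w ξ * localMarginal W ι ξ)
      = fun ξ => w ξ / Z * localMarginal W ι ξ := by
    funext ξ
    rw [normalized, ← htotal, div_mul_eq_mul_div]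
  rw [hV, hT]
  exact siteCorrelation_comp_mul hι hF (fun ξ => w ξ / Z) hW hWF r

theorem exists_siteCorrelation_normalized_mul_near {w : (T → X) → ℝ} (hw : ∀ ξ, 0 ≤ w ξ) (r : T)
    (F : Set T) {c : ℝ} (hc : c ≠ 0) {ε : ℝ} (hε : 0 < ε) :
    ∃ θ > 0, ∀ μ : (T → X) → ℝ, (∀ ξ, |μ ξ - c| < θ) →
      |siteCorrelation r F (normalized fun ξ => w ξ * μ ξ)
        - siteCorrelation r F (normalized w)| < ε := by
  rcases eq_or_ne (∑ ξ, w ξ) 0 with hsum | hsum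
  · have hzero : w = 0 := (Fintype.sum_eq_zero_iff_of_nonneg hw).1 hsum
    refine ⟨1, one_pos, fun μ _ => ?_⟩
    have hmul : (fun ξ => w ξ * μ ξ) = w := by simp [hzero, funext_iff]
    rwa [hmul, sub_self, abs_zero]
  have hcont : ContinuousAt
      (fun μ : (T → X) → ℝ => siteCorrelation r F (normalized fun ξ => w ξ * μ ξ))
      (fun _ => c) := by
    refine ContinuousAt.comp (g := siteCorrelation r F)
      (continuous_siteCorrelation r F).continuousAt (continuousAt_pi.2 fun ξ => ?_)
    have hden : ∑ ξ, w ξ * c ≠ 0 := by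
      rw [← Finset.sum_mul]
      exact mul_ne_zero hsum hc
    have hnum (ξ : T → X) : Continuous fun μ : (T → X) → ℝ => w ξ * μ ξ :=
      continuous_const.mul (continuous_apply ξ)
    exact (hnum ξ).continuousAt.div
      (continuous_finsetSum _ fun ξ _ => hnum ξ).continuousAt hden
  obtain ⟨θ, hθ, h⟩ := Metric.continuousAt_iff.1 hcont ε hε
  refine ⟨θ, hθ, fun μ hμ => ?_⟩
  simpa only [Real.dist_eq, normalized_mul_const w hc] using h ((dist_pi_lt_iff hθ).2 hμ)

end Normalized

namespace LabeledMultigraph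

variable {V C X : Type*} [Fintype V] [DecidableEq V] [Fintype X]

theorem partitionFunction_eq_sum (G : LabeledMultigraph V C) (ψ : C → Sym2 X → ℝ≥0) :
    G.partitionFunction ψ = ∑ x, G.weight ψ x := by
  unfold partitionFunction
  congr!

theorem gibbs_eq_normalized (G : LabeledMultigraph V C) (ψ : C → Sym2 X → ℝ≥0) :
    G.gibbs ψ = normalized (G.weight ψ) := by
  funext x
  rw [gibbs, partitionFunction_eq_sum, normalized]

theorem rootCorrelation_eq_siteCorrelation (G : LabeledMultigraph V C) (ψ : C → Sym2 X → ℝ≥0)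
    (r : V) (t : ℕ) :
    G.rootCorrelation ψ r t = siteCorrelation r (G.farSet r t) (G.gibbs ψ) := by
  classical
  have hroot (a : X) : G.rootMarginal ψ r a = siteMarginal r (G.gibbs ψ) a := by
    simp only [rootMarginal, siteMarginal, ite_mul, one_mul, zero_mul]
    congr!
  have hjoint (U : Set V) (a : X) (y : U → X) :
      G.jointMarginal ψ r U a y - G.rootMarginal ψ r a * G.marginal ψ U y
        = localMarginal
          (fun x => ((if x r = a then 1 else 0) - siteMarginal r (G.gibbs ψ) a) * G.gibbs ψ x)
          ((↑) : U → V) y := by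
    simp only [hroot, jointMarginal, marginal, localMarginal, Finset.mul_sum]
    rw [← Finset.sum_sub_distrib]
    refine Finset.sum_congr (by congr!) fun x _ => ?_
    by_cases hr : x r = a <;> by_cases hy : (fun j : U => x j) = y <;>
      simp [hr, hy, Function.comp_def, sub_mul]
  simp only [rootCorrelation, siteCorrelation, hjoint]
  congr!

end LabeledMultigraph

section Layered

variable {V : Type*}

theorem depth_le_add_walk_length {G : SimpleGraph V} {d : V → ℕ}
    (hadj : ∀ v w, G.Adj v w → d w ≤ d v + 1) {u v : V} (p : G.Walk u v) :
    d v ≤ d u + p.length := by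
  induction p with
  | nil => simp
  | cons h p ih =>
    have := hadj _ _ h
    rw [SimpleGraph.Walk.length_cons]
    lia

theorem edist_le_depth {G : SimpleGraph V} {d : V → ℕ} {r : V} {ℓ : ℕ}
    (hparent : ∀ v, d v < ℓ → v = r ∨ ∃ w, G.Adj w v ∧ d v = d w + 1) {v : V} (hv : d v < ℓ) :
    G.edist r v ≤ d v := by
  induction hn : d v generalizing v with
  | zero =>
    rcases hparent v hv with rfl | ⟨w, -, hw⟩
    · simp
    · lia
  | succ n ih =>
    rcases hparent v hv with rfl | ⟨w, hadj, hw⟩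
    · simp
    · have hdw : d w = n := by lia
      calc G.edist r v ≤ G.edist r w + G.edist w v := SimpleGraph.edist_triangle
        _ ≤ n + 1 := add_le_add (ih (by lia) hdw) (SimpleGraph.edist_eq_one_iff_adj.2 hadj).le
        _ = ((n + 1 : ℕ) : ℕ∞) := by push_cast; rfl

variable {T C : Type*}

namespace LabeledMultigraph

theorem farSet_eq_of_depth (G : LabeledMultigraph V C) {r : V} {d : V → ℕ} {ℓ t : ℕ}
    (ht : t ≤ ℓ) (hr : d r = 0) (hadj : ∀ v w, G.toSimpleGraph.Adj v w → d w ≤ d v + 1)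
    (hparent : ∀ v, d v < ℓ → v = r ∨ ∃ w, G.toSimpleGraph.Adj w v ∧ d v = d w + 1) :
    G.farSet r t = {v | t ≤ d v} := by
  ext v
  constructor
  · intro h
    by_contra hlt
    rw [Set.mem_ofPred_eq, not_le] at hlt
    have hle : (t : ℕ∞) ≤ d v := le_trans h (edist_le_depth hparent (hlt.trans_le ht))
    exact hlt.not_ge (by exact_mod_cast hle)
  · intro h
    refine le_iInf (α := ℕ∞) fun p => ?_
    have hp := depth_le_add_walk_length hadj p
    rw [hr, zero_add] at hp
    exact_mod_cast le_trans h hp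

theorem toSimpleGraph_adj (G : LabeledMultigraph V C) (v w : V) :
    G.toSimpleGraph.Adj v w ↔ (∃ k, G.ends k = s(v, w)) ∧ v ≠ w := by
  simp [toSimpleGraph]

end LabeledMultigraph

/-- A multigraph without multiple edges, graded by a depth of at most `ℓ`: all edges join
consecutive depths, and every vertex other than `r` has a neighbour one level closer to `r`. It
captures what the proof uses of a Galton–Watson tree truncated at depth `ℓ`. -/
structure IsLayered (G : LabeledMultigraph T C) (r : T) (depth : T → ℕ) (ℓ : ℕ) : Prop where
  ends_injective : Function.Injective G.ends
  depth_root : depth r = 0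
  depth_le : ∀ u, depth u ≤ ℓ
  exists_parent : ∀ v, v = r ∨ ∃ k u, G.ends k = s(u, v) ∧ depth v = depth u + 1
  edge_depth : ∀ k, ∃ u v, G.ends k = s(u, v) ∧ depth v = depth u + 1

namespace IsLayered

variable {G : LabeledMultigraph T C} {r : T} {depth : T → ℕ} {ℓ : ℕ}

theorem depth_le_of_ends_eq (h : IsLayered G r depth ℓ) {k : G.Edge} {u v : T}
    (hk : G.ends k = s(u, v)) : depth v ≤ depth u + 1 := by
  obtain ⟨u', v', hk', hdepth⟩ := h.edge_depth k
  rw [hk, Sym2.eq_iff] at hk'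
  rcases hk' with ⟨rfl, rfl⟩ | ⟨rfl, rfl⟩ <;> lia

theorem farSet_eq (h : IsLayered G r depth ℓ) (t : ℕ) : G.farSet r t = {v | t ≤ depth v} := by
  refine G.farSet_eq_of_depth le_rfl h.depth_root (fun v w hvw => ?_) fun v _ => ?_
  · obtain ⟨⟨k, hk⟩, -⟩ := (G.toSimpleGraph_adj v w).1 hvw
    exact h.depth_le_of_ends_eq hk
  · refine (h.exists_parent v).imp_right fun ⟨k, u, hk, hdepth⟩ => ?_
    refine ⟨u, (G.toSimpleGraph_adj u v).2 ⟨⟨k, hk⟩, ?_⟩, hdepth⟩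
    rintro rfl
    lia

end IsLayered

end Layered

section Planting

variable {T V C X : Type*}

/-- The lists of labels of the image of a multigraph without multiple edges under `ι`. -/
noncomputable def plantedLists (G : LabeledMultigraph T C) (ι : T → V) : Sym2 V → List C :=
  Function.extend (fun k => (G.ends k).map ι) (fun k => [G.label k]) fun _ => []

/-- The pairs which meet the image of `I`. -/
def touching (I : Set T) (ι : T → V) : Set (Sym2 V) := {e | ∃ u ∈ I, ι u ∈ e}

/-- The event that the edges meeting the image of `I` are exactly those of the image of `G`, so
that a copy of `G` is planted which is attached to the rest only outside of `I`. -/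
def plantedEvent (G : LabeledMultigraph T C) (I : Set T) (ι : T → V) : Set (Sym2 V → List C) :=
  {g | ∀ e ∈ touching I ι, g e = plantedLists G ι e}

open Classical in
/-- The multigraph left when the edges which meet the image of `I` are removed. -/
noncomputable def removeTouching (I : Set T) (ι : T → V) (g : Sym2 V → List C) :
    Sym2 V → List C :=
  fun e => if e ∈ touching I ι then [] else g e

/-- The vertices of depth less than `ℓ`. -/
def innerSet (depth : T → ℕ) (ℓ : ℕ) : Set T := {u | depth u < ℓ}

theorem plantedLists_map_ends {G : LabeledMultigraph T C} (hG : G.ends.Injective)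
    {ι : T → V} (hι : ι.Injective) (k : G.Edge) :
    plantedLists G ι ((G.ends k).map ι) = [G.label k] :=
  ((Sym2.map.injective hι).comp hG).extend_apply _ _ k

theorem plantedLists_of_notMem_range {G : LabeledMultigraph T C} {ι : T → V} {e : Sym2 V}
    (h : e ∉ Set.range fun k => (G.ends k).map ι) : plantedLists G ι e = [] :=
  Function.extend_apply' _ _ _ h

theorem weight_multigraphOfLists {N : ℕ} (g : Sym2 (Fin N) → List C) (ψ : C → Sym2 X → ℝ≥0)
    (x : Fin N → X) : (multigraphOfLists N g).weight ψ x
      = ∏ e, ((g e).map fun a => (ψ a (e.map x) : ℝ)).prod := by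
  have hlist (e : Sym2 (Fin N)) : ((g e).map fun a => (ψ a (e.map x) : ℝ)).prod
      = ∏ i : Fin (g e).length, (ψ ((g e).get i) (e.map x) : ℝ) := by
    rw [← List.prod_ofFn]
    conv_lhs => rw [← List.ofFn_get (g e), List.map_ofFn]
    rfl
  simp only [hlist]
  exact Fintype.prod_sigma fun k : (Σ e : Sym2 (Fin N), Fin (g e).length) =>
    (ψ ((g k.1).get k.2) (k.1.map x) : ℝ)

theorem LabeledMultigraph.weight_nonneg (G : LabeledMultigraph V C) (ψ : C → Sym2 X → ℝ≥0)
    (x : V → X) : 0 ≤ G.weight ψ x :=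
  Finset.prod_nonneg fun _ _ => NNReal.coe_nonneg _

theorem weight_removeTouching_factorsThrough {N : ℕ} {I : Set T} {ι : T → Fin N}
    {F : Set (Fin N)} (hF : (ι '' I)ᶜ ⊆ F) (g : Sym2 (Fin N) → List C) (ψ : C → Sym2 X → ℝ≥0) :
    ((multigraphOfLists N (removeTouching I ι g)).weight ψ).FactorsThrough F.domRestrict := by
  intro x x' hx
  rw [weight_multigraphOfLists, weight_multigraphOfLists]
  refine Finset.prod_congr rfl fun e _ => ?_
  by_cases he : e ∈ touching I ι
  · simp [removeTouching, he]
  · have hmap : e.map x = e.map x' := by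
      refine Sym2.map_congr fun v hv => congrFun hx ⟨v, hF ?_⟩
      rintro ⟨u, hu, rfl⟩
      exact he ⟨u, hu, hv⟩
    rw [hmap]

theorem partitionFunction_removeTouching_pos [Fintype X] (I : Set T) {N : ℕ} (ι : T → Fin N)
    {g : Sym2 (Fin N) → List C} {ψ : C → Sym2 X → ℝ≥0}
    (hg : 0 < (multigraphOfLists N g).partitionFunction ψ) :
    0 < (multigraphOfLists N (removeTouching I ι g)).partitionFunction ψ := by
  rw [LabeledMultigraph.partitionFunction_eq_sum] at hg ⊢
  obtain ⟨x, -, hx⟩ := Finset.exists_ne_zero_of_sum_ne_zero hg.ne'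
  refine Finset.sum_pos' (fun x _ => LabeledMultigraph.weight_nonneg _ _ _)
    ⟨x, Finset.mem_univ _, (LabeledMultigraph.weight_nonneg _ _ _).lt_of_ne' ?_⟩
  rw [weight_multigraphOfLists, Finset.prod_ne_zero_iff] at hx ⊢
  intro e he
  unfold removeTouching
  split_ifs
  · simp
  · exact hx e he

theorem multigraphOfLists_adj {N : ℕ} (g : Sym2 (Fin N) → List C) (v w : Fin N) :
    (multigraphOfLists N g).toSimpleGraph.Adj v w ↔ g s(v, w) ≠ [] ∧ v ≠ w := by
  rw [LabeledMultigraph.toSimpleGraph_adj]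
  refine and_congr_left fun _ => ⟨?_, fun h => ⟨⟨s(v, w), 0, List.length_pos_iff.2 h⟩, rfl⟩⟩
  rintro ⟨⟨e, i⟩, rfl : e = s(v, w)⟩ hnil
  rw [hnil] at i
  exact i.elim0

namespace IsLayered

variable {G : LabeledMultigraph T C} {r : T} {depth : T → ℕ} {ℓ : ℕ}

theorem map_ends_mem_touching (h : IsLayered G r depth ℓ) (ι : T → V) (k : G.Edge) :
    (G.ends k).map ι ∈ touching (innerSet depth ℓ) ι := by
  obtain ⟨u, v, hk, hdepth⟩ := h.edge_depth k
  have hu : depth u < ℓ := by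
    have := h.depth_le v
    lia
  exact ⟨u, hu, by simp [hk]⟩

variable {N : ℕ} {ι : T → Fin N} {g : Sym2 (Fin N) → List C}

theorem weight_eq_mul (h : IsLayered G r depth ℓ) (hι : ι.Injective)
    (hg : g ∈ plantedEvent G (innerSet depth ℓ) ι) (ψ : C → Sym2 X → ℝ≥0) (x : Fin N → X) :
    (multigraphOfLists N g).weight ψ x = G.weight ψ (x ∘ ι) *
      (multigraphOfLists N (removeTouching (innerSet depth ℓ) ι g)).weight ψ x := by
  have hplanted : G.weight ψ (x ∘ ι)
      = ∏ e, ((plantedLists G ι e).map fun a => (ψ a (e.map x) : ℝ)).prod := by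
    refine Fintype.prod_of_injective (fun k => (G.ends k).map ι)
      ((Sym2.map.injective hι).comp h.ends_injective) _ _ (fun e he => ?_) fun k => ?_
    · simp [plantedLists_of_notMem_range he]
    · simp [plantedLists_map_ends h.ends_injective hι, Sym2.map_map]
  rw [weight_multigraphOfLists, weight_multigraphOfLists, hplanted, ← Finset.prod_mul_distrib]
  refine Finset.prod_congr rfl fun e _ => ?_
  by_cases he : e ∈ touching (innerSet depth ℓ) ι
  · simp [removeTouching, he, hg e he]
  · have hnil : plantedLists G ι e = [] := plantedLists_of_notMem_range fun ⟨k, hk⟩ =>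
      he (hk ▸ h.map_ends_mem_touching ι k)
    simp [removeTouching, he, hnil]

theorem extend_depth_le_of_adj (h : IsLayered G r depth ℓ) (hι : ι.Injective)
    (hg : g ∈ plantedEvent G (innerSet depth ℓ) ι) {v w : Fin N}
    (hvw : (multigraphOfLists N g).toSimpleGraph.Adj v w) :
    Function.extend ι depth (fun _ => ℓ) w ≤ Function.extend ι depth (fun _ => ℓ) v + 1 := by
  obtain ⟨hne, -⟩ := (multigraphOfLists_adj g v w).1 hvw
  by_cases he : s(v, w) ∈ touching (innerSet depth ℓ) ι
  · rw [hg _ he] at hne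
    obtain ⟨k, hk⟩ := not_imp_comm.1 plantedLists_of_notMem_range hne
    obtain ⟨u₁, u₂, hu, hdepth⟩ := h.edge_depth k
    simp only [hu, Sym2.map_mk] at hk
    rcases Sym2.eq_iff.1 hk with ⟨rfl, rfl⟩ | ⟨rfl, rfl⟩ <;> simp only [hι.extend_apply] <;> lia
  · have houter (z : Fin N) (hz : z ∈ s(v, w)) : Function.extend ι depth (fun _ => ℓ) z = ℓ := by
      by_cases hzι : ∃ u, ι u = z
      · obtain ⟨u, rfl⟩ := hzι
        rw [hι.extend_apply]
        exact (h.depth_le u).antisymm (not_lt.1 fun hu => he ⟨u, hu, hz⟩)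
      · exact Function.extend_apply' _ _ _ hzι
    rw [houter v (Sym2.mem_mk_left _ _), houter w (Sym2.mem_mk_right _ _)]
    lia

theorem exists_parent_extend_depth (h : IsLayered G r depth ℓ) (hι : ι.Injective)
    (hg : g ∈ plantedEvent G (innerSet depth ℓ) ι) {v : Fin N}
    (hv : Function.extend ι depth (fun _ => ℓ) v < ℓ) :
    v = ι r ∨ ∃ w, (multigraphOfLists N g).toSimpleGraph.Adj w v ∧
      Function.extend ι depth (fun _ => ℓ) v = Function.extend ι depth (fun _ => ℓ) w + 1 := by
  obtain ⟨u, rfl⟩ : ∃ u, ι u = v := by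
    by_contra hvι
    exact hv.ne (Function.extend_apply' _ _ _ hvι)
  refine (h.exists_parent u).imp (congrArg ι) fun ⟨k, p, hk, hdepth⟩ =>
    ⟨ι p, (multigraphOfLists_adj g _ _).2 ⟨?_, ?_⟩, by simp only [hι.extend_apply, hdepth]⟩
  · rw [← Sym2.map_mk, ← hk, hg _ (h.map_ends_mem_touching ι k),
      plantedLists_map_ends h.ends_injective hι]
    exact List.cons_ne_nil _ _
  · intro heq
    rw [hι heq] at hdepth
    lia

theorem farSet_multigraphOfLists (h : IsLayered G r depth ℓ) (hι : ι.Injective)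
    (hg : g ∈ plantedEvent G (innerSet depth ℓ) ι) {t : ℕ} (ht : t ≤ ℓ) :
    (multigraphOfLists N g).farSet (ι r) t
      = {v | t ≤ Function.extend ι depth (fun _ => ℓ) v} :=
  LabeledMultigraph.farSet_eq_of_depth _ ht (by rw [hι.extend_apply, h.depth_root])
    (fun _ _ hvw => h.extend_depth_le_of_adj hι hg hvw)
    fun _ hv => h.exists_parent_extend_depth hι hg hv

theorem preimage_farSet_multigraphOfLists (h : IsLayered G r depth ℓ) (hι : ι.Injective)
    (hg : g ∈ plantedEvent G (innerSet depth ℓ) ι) {t : ℕ} (ht : t ≤ ℓ) :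
    ι ⁻¹' (multigraphOfLists N g).farSet (ι r) t = G.farSet r t := by
  rw [h.farSet_multigraphOfLists hι hg ht, h.farSet_eq]
  ext u
  simp [hι.extend_apply]

theorem compl_image_innerSet_subset_farSet (h : IsLayered G r depth ℓ) (hι : ι.Injective)
    (hg : g ∈ plantedEvent G (innerSet depth ℓ) ι) {t : ℕ} (ht : t ≤ ℓ) :
    (ι '' innerSet depth ℓ)ᶜ ⊆ (multigraphOfLists N g).farSet (ι r) t := by
  rw [h.farSet_multigraphOfLists hι hg ht]
  intro v hv
  by_cases hvι : ∃ u, ι u = v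
  · obtain ⟨u, rfl⟩ := hvι
    rw [Set.mem_ofPred_eq, hι.extend_apply]
    exact ht.trans (not_lt.1 fun hu => hv ⟨u, hu, rfl⟩)
  · rwa [Set.mem_ofPred_eq, Function.extend_apply' _ _ _ hvι]

variable [Fintype T] [Fintype X]

theorem rootCorrelation_multigraphOfLists [DecidableEq T] (h : IsLayered G r depth ℓ)
    (hι : ι.Injective) (hg : g ∈ plantedEvent G (innerSet depth ℓ) ι) {t : ℕ} (ht : t ≤ ℓ)
    {ψ : C → Sym2 X → ℝ≥0} (hpos : 0 < (multigraphOfLists N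
      (removeTouching (innerSet depth ℓ) ι g)).partitionFunction ψ) :
    (multigraphOfLists N g).rootCorrelation ψ (ι r) t
      = siteCorrelation r (G.farSet r t) (normalized fun ξ => G.weight ψ ξ * localMarginal
          ((multigraphOfLists N (removeTouching (innerSet depth ℓ) ι g)).gibbs ψ) ι ξ) := by
  have hF := h.compl_image_innerSet_subset_farSet hι hg ht
  rw [LabeledMultigraph.partitionFunction_eq_sum] at hpos
  rw [LabeledMultigraph.rootCorrelation_eq_siteCorrelation,
    LabeledMultigraph.gibbs_eq_normalized, LabeledMultigraph.gibbs_eq_normalized,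
    funext (h.weight_eq_mul hι hg ψ),
    siteCorrelation_normalized_comp_mul hι
      ((Set.compl_subset_comm.1 hF).trans (Set.image_subset_range _ _)) (G.weight ψ)
      (LabeledMultigraph.weight_nonneg _ ψ) hpos.ne'
      (weight_removeTouching_factorsThrough hF g ψ) r,
    h.preimage_farSet_multigraphOfLists hι hg ht]

-- The planted copy sees the rest of the graph only through the weights `localMarginal … ι`; where
-- these are nearly constant, the normalization cancels them.
theorem exists_rootCorrelation_near [Nonempty X] (h : IsLayered G r depth ℓ)
    (ψ : C → Sym2 X → ℝ≥0) {t : ℕ} (ht : t ≤ ℓ) {ε : ℝ} (hε : 0 < ε) :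
    ∃ θ : ℝ, 0 < θ ∧ ∀ (N : ℕ) (ι : T → Fin N), ι.Injective →
      ∀ g ∈ plantedEvent G (innerSet depth ℓ) ι,
      0 < (multigraphOfLists N (removeTouching (innerSet depth ℓ) ι g)).partitionFunction ψ →
      (∀ ξ, |localMarginal ((multigraphOfLists N
        (removeTouching (innerSet depth ℓ) ι g)).gibbs ψ) ι ξ
          - (Fintype.card X : ℝ)⁻¹ ^ Fintype.card T| < θ) →
      |(multigraphOfLists N g).rootCorrelation ψ (ι r) t - G.rootCorrelation ψ r t| < ε := by
  classical
  have hc : (Fintype.card X : ℝ)⁻¹ ^ Fintype.card T ≠ 0 := by positivity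
  obtain ⟨θ, hθ, hnear⟩ :=
    exists_siteCorrelation_normalized_mul_near (G.weight_nonneg ψ) r (G.farSet r t) hc hε
  refine ⟨θ, hθ, fun N ι hι g hg hpos hξ => ?_⟩
  rw [h.rootCorrelation_multigraphOfLists hι hg ht hpos, G.rootCorrelation_eq_siteCorrelation,
    G.gibbs_eq_normalized]
  exact hnear _ hξ

end IsLayered

end Planting

section Independence

theorem measureReal_pi_inter_of_dependsOn {ι : Type*} [Fintype ι] {α : ι → Type*}
    [∀ i, MeasurableSpace (α i)] [∀ i, Countable (α i)] [∀ i, MeasurableSingletonClass (α i)]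
    (μ : ∀ i, Measure (α i)) [∀ i, IsProbabilityMeasure (μ i)] {S : Set ι} {A B : Set (∀ i, α i)}
    (hA : DependsOn (· ∈ A) S) (hB : DependsOn (· ∈ B) Sᶜ) :
    (Measure.pi μ).real (A ∩ B) = (Measure.pi μ).real A * (Measure.pi μ).real B := by
  classical
  have hindep := (iIndepFun_pi (μ := μ) (X := fun i (a : α i) => a)
    fun _ => aemeasurable_id).indepFun_finset S.toFinset Sᶜ.toFinset
      (Set.disjoint_toFinset.2 disjoint_compl_right) fun i => measurable_pi_apply i
  have hpreimage {S : Set ι} [Fintype S] {A : Set (∀ i, α i)} (hA : DependsOn (· ∈ A) S) :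
      (fun x (i : S.toFinset) => x i) ⁻¹' ((fun x (i : S.toFinset) => x i) '' A) = A := by
    refine Set.Subset.antisymm ?_ (Set.subset_preimage_image _ _)
    rintro x ⟨y, hy, hxy⟩
    exact (hA fun i hi => congrFun hxy ⟨i, Set.mem_toFinset.2 hi⟩).mp hy
  have h := (indepFun_iff_measure_inter_preimage_eq_mul.1 hindep)
    ((fun x (i : S.toFinset) => x i) '' A) ((fun x (i : Sᶜ.toFinset) => x i) '' B)
    .of_discrete .of_discrete
  rw [hpreimage hA, hpreimage hB] at h
  simp only [measureReal_def, h, ENNReal.toReal_mul]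

end Independence

section PoissonList

variable {C : Type*}

theorem iidList_apply (p : PMF C) (n : ℕ) (l : List C) :
    iidList p n l = if l.length = n then (l.map p).prod else 0 := by
  classical
  induction n generalizing l with
  | zero => cases l <;> simp [iidList, PMF.pure_apply]
  | succ n ih =>
    simp only [iidList, PMF.bind_apply, PMF.map_apply]
    cases l with
    | nil => simp
    | cons b l =>
      rw [tsum_eq_single b fun a ha => by simp [ha.symm],
        tsum_eq_single l fun l' hl' => by simp [hl'.symm]]
      simp [ih]

theorem poissonList_apply (m : ℝ≥0) (p : PMF C) (l : List C) :
    poissonList m p l = ENNReal.ofReal (Real.exp (-m) * m ^ l.length / (l.length).factorial)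
      * (l.map p).prod := by
  rw [poissonList, PMF.bind_apply, tsum_eq_single l.length fun n hn => by
    rw [iidList_apply, if_neg hn.symm, mul_zero]]
  rw [iidList_apply, if_pos rfl, Measure.toPMF_apply, poissonMeasure_singleton]

instance listMeasurableSingletonClass : MeasurableSingletonClass (List C) :=
  ⟨fun _ => trivial⟩

theorem poissonList_real_singleton (m : ℝ≥0) (p : PMF C) (l : List C) :
    (poissonList m p).toMeasure.real {l} = Real.exp (-m) * m ^ l.length / (l.length).factorial
      * (l.map fun a => (p a).toReal).prod := by
  have hprod : ((l.map p).prod).toReal = (l.map fun a => (p a).toReal).prod := by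
    induction l with
    | nil => simp
    | cons a l ih => simp [ih]
  rw [measureReal_def, PMF.toMeasure_apply_singleton _ _ (measurableSet_singleton l),
    poissonList_apply, ENNReal.toReal_mul, ENNReal.toReal_ofReal (by positivity), hprod]

end PoissonList

section GraphLaw

variable {C X T : Type*} (M : PoissonEnsemble X C)

open Classical in
/-- The mean number of edges with given end points. -/
noncomputable def edgeMean (γ : ℝ≥0) (N : ℕ) (e : Sym2 (Fin N)) : ℝ≥0 :=
  if e.IsDiag then γ / N else 2 * γ / N

theorem edgeMean_le (γ : ℝ≥0) {N : ℕ} (e : Sym2 (Fin N)) : edgeMean γ N e ≤ 2 * γ / N := by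
  unfold edgeMean
  split_ifs
  · gcongr
    exact le_mul_of_one_le_left' one_le_two
  · exact le_rfl

theorem graphLaw_eq (N : ℕ) :
    M.graphLaw N = Measure.pi fun e => (poissonList (edgeMean M.γ N e) M.p).toMeasure := by
  unfold PoissonEnsemble.graphLaw edgeMean
  congr!

instance isProbabilityMeasure_graphLaw (N : ℕ) : IsProbabilityMeasure (M.graphLaw N) := by
  rw [graphLaw_eq]
  infer_instance

theorem graphLaw_real_forall_mem_eq {N : ℕ} (S : Set (Sym2 (Fin N))) [DecidablePred (· ∈ S)]
    (L : Sym2 (Fin N) → List C) : (M.graphLaw N).real {g | ∀ e ∈ S, g e = L e}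
      = ∏ e, if e ∈ S then (poissonList (edgeMean M.γ N e) M.p).toMeasure.real {L e} else 1 := by
  have hpi : {g | ∀ e ∈ S, g e = L e} = Set.univ.pi fun e => if e ∈ S then {L e} else .univ := by
    ext g
    simp only [Set.mem_ofPred_eq, Set.mem_univ_pi]
    refine forall_congr' fun e => ?_
    by_cases he : e ∈ S <;> simp [he]
  rw [hpi, measureReal_def, graphLaw_eq, Measure.pi_pi, ENNReal.toReal_prod]
  refine Finset.prod_congr rfl fun e _ => ?_
  split_ifs
  · rfl
  · simp

/-- The event that no edge meets the image of `I`. -/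
def isolatedEvent {V : Type*} (I : Set T) (ι : T → V) : Set (Sym2 V → List C) :=
  {g | ∀ e ∈ touching I ι, g e = []}

theorem graphLaw_real_isolatedEvent {N : ℕ} (I : Set T) (ι : T → Fin N)
    [DecidablePred (· ∈ touching I ι)] : (M.graphLaw N).real (isolatedEvent I ι)
      = ∏ e, if e ∈ touching I ι then Real.exp (-edgeMean M.γ N e) else 1 := by
  rw [isolatedEvent, graphLaw_real_forall_mem_eq M (touching I ι) fun _ => []]
  simp [poissonList_real_singleton]

theorem card_touching_le {N : ℕ} {I : Set T} (hI : I.Finite) (ι : T → Fin N)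
    [DecidablePred (· ∈ touching I ι)] :
    (Finset.univ.filter (· ∈ touching I ι)).card ≤ I.ncard * N := by
  classical
  have hsub : Finset.univ.filter (· ∈ touching I ι)
      ⊆ (hI.toFinset ×ˢ (Finset.univ : Finset (Fin N))).image fun z => s(ι z.1, z.2) := by
    intro e he
    obtain ⟨u, hu, hue⟩ := (Finset.mem_filter.1 he).2
    obtain ⟨v, rfl⟩ := Sym2.mem_iff_exists.1 hue
    exact Finset.mem_image.2 ⟨(u, v), by simpa using hu, rfl⟩
  refine (Finset.card_le_card hsub).trans (Finset.card_image_le.trans_eq ?_)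
  rw [Finset.card_product, Finset.card_univ, Fintype.card_fin, Set.ncard_eq_toFinset_card I hI]

theorem exp_neg_le_graphLaw_real_isolatedEvent {N : ℕ} (hN : N ≠ 0) {I : Set T}
    (hI : I.Finite) (ι : T → Fin N) :
    Real.exp (-(2 * M.γ)) ^ I.ncard ≤ (M.graphLaw N).real (isolatedEvent I ι) := by
  classical
  have hcard : ((Finset.univ.filter (· ∈ touching I ι)).card : ℝ) ≤ I.ncard * N := by
    exact_mod_cast card_touching_le hI ι
  rw [graphLaw_real_isolatedEvent]
  calc Real.exp (-(2 * M.γ)) ^ I.ncard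
      = Real.exp (-(I.ncard * N * (2 * M.γ / N))) := by
        rw [← Real.exp_nat_mul]
        field_simp
    _ ≤ Real.exp (-((Finset.univ.filter (· ∈ touching I ι)).card * (2 * M.γ / N))) := by
        gcongr
    _ = ∏ e, if e ∈ touching I ι then Real.exp (-(2 * M.γ / N)) else 1 := by
        rw [← Finset.prod_filter, Finset.prod_const, ← Real.exp_nat_mul, mul_neg]
    _ ≤ ∏ e, if e ∈ touching I ι then Real.exp (-edgeMean M.γ N e) else 1 := by
        gcongr with e
        split_ifs
        · gcongr
          exact_mod_cast edgeMean_le M.γ e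
        · exact le_rfl

/-- The ratio of the probability that a copy of `G` is planted to the probability that its inner
vertices are isolated. -/
noncomputable def plantingFactor (N : ℕ) (G : LabeledMultigraph T C) : ℝ :=
  ∏ k : G.Edge, (2 * M.γ / N * (M.p (G.label k)).toReal : ℝ)

theorem plantingFactor_le (N : ℕ) (G : LabeledMultigraph T C) :
    plantingFactor M N G ≤ (2 * M.γ / N : ℝ) ^ Fintype.card G.Edge :=
  calc plantingFactor M N G ≤ ∏ _k : G.Edge, (2 * M.γ / N : ℝ) :=
        Finset.prod_le_prod (fun _ _ => by positivity) fun k _ =>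
          mul_le_of_le_one_right (by positivity)
            (ENNReal.toReal_mono ENNReal.one_ne_top (M.p.coe_le_one _))
    _ = _ := by rw [Finset.prod_const, Finset.card_univ]

theorem plantingFactor_mul_pow {N : ℕ} (hN : N ≠ 0) (G : LabeledMultigraph T C) :
    plantingFactor M N G * (N : ℝ) ^ Fintype.card G.Edge
      = ∏ k, (2 * M.γ * (M.p (G.label k)).toReal : ℝ) := by
  rw [plantingFactor, ← Finset.card_univ, ← Finset.prod_const, ← Finset.prod_mul_distrib]
  exact Finset.prod_congr rfl fun k _ => by field_simp

variable {r : T} {depth : T → ℕ} {ℓ : ℕ} {G : LabeledMultigraph T C}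

theorem IsLayered.not_isDiag_map_ends {V : Type*} (h : IsLayered G r depth ℓ) {ι : T → V}
    (hι : ι.Injective) (k : G.Edge) : ¬ ((G.ends k).map ι).IsDiag := by
  obtain ⟨u, v, hk, hdepth⟩ := h.edge_depth k
  rw [hk, Sym2.map_mk, Sym2.mk_isDiag_iff]
  intro huv
  rw [hι huv] at hdepth
  lia

theorem IsLayered.graphLaw_real_plantedEvent (h : IsLayered G r depth ℓ) {N : ℕ}
    {ι : T → Fin N} (hι : ι.Injective) :
    (M.graphLaw N).real (plantedEvent G (innerSet depth ℓ) ι)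
      = (M.graphLaw N).real (isolatedEvent (innerSet depth ℓ) ι) * plantingFactor M N G := by
  classical
  have hfactor : plantingFactor M N G = ∏ e : Sym2 (Fin N),
      if e ∈ touching (innerSet depth ℓ) ι then
        (edgeMean M.γ N e : ℝ) ^ (plantedLists G ι e).length
          / ((plantedLists G ι e).length).factorial
          * ((plantedLists G ι e).map fun a => (M.p a).toReal).prod else 1 := by
    refine Fintype.prod_of_injective (fun k => (G.ends k).map ι)
      ((Sym2.map.injective hι).comp h.ends_injective) _ _ (fun e he => ?_) fun k => ?_
    · simp [plantedLists_of_notMem_range he]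
    · simp [h.map_ends_mem_touching ι k, plantedLists_map_ends h.ends_injective hι, edgeMean,
        h.not_isDiag_map_ends hι k]
  rw [plantedEvent, graphLaw_real_forall_mem_eq, graphLaw_real_isolatedEvent, hfactor,
    ← Finset.prod_mul_distrib]
  refine Finset.prod_congr rfl fun e _ => ?_
  split_ifs
  · rw [poissonList_real_singleton]
    ring
  · simp

variable [Countable C]

theorem graphLaw_real_inter_removeTouching {N : ℕ} (I : Set T) (ι : T → Fin N)
    (L : Sym2 (Fin N) → List C) (B : Set (Sym2 (Fin N) → List C)) :
    (M.graphLaw N).real ({g | ∀ e ∈ touching I ι, g e = L e} ∩ removeTouching I ι ⁻¹' B)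
      = (M.graphLaw N).real {g | ∀ e ∈ touching I ι, g e = L e}
        * (M.graphLaw N).real (removeTouching I ι ⁻¹' B) := by
  rw [graphLaw_eq]
  refine measureReal_pi_inter_of_dependsOn _ (S := touching I ι) (fun g g' hgg' => ?_)
    fun g g' hgg' => ?_
  · exact propext (forall₂_congr fun e he => by rw [hgg' e he])
  · have hremove : removeTouching I ι g = removeTouching I ι g' := by
      funext e
      unfold removeTouching
      split_ifs with he
      · rfl
      · exact hgg' e he
    simp only [Set.mem_preimage, hremove]

-- On `isolatedEvent` the map `removeTouching` is the identity, and the isolated and the planted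
-- configurations only differ by the planting factor.
theorem IsLayered.graphLaw_real_plantedEvent_mul_le (h : IsLayered G r depth ℓ) {N : ℕ}
    {ι : T → Fin N} (hι : ι.Injective) (B : Set (Sym2 (Fin N) → List C)) :
    (M.graphLaw N).real (plantedEvent G (innerSet depth ℓ) ι)
        * (M.graphLaw N).real (removeTouching (innerSet depth ℓ) ι ⁻¹' B)
      ≤ (2 * M.γ / N : ℝ) ^ Fintype.card G.Edge * (M.graphLaw N).real B := by
  set I := innerSet depth ℓ
  have hisolated : (M.graphLaw N).real (isolatedEvent I ι ∩ removeTouching I ι ⁻¹' B)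
      = (M.graphLaw N).real (isolatedEvent I ι)
        * (M.graphLaw N).real (removeTouching I ι ⁻¹' B) :=
    graphLaw_real_inter_removeTouching M I ι (fun _ => []) B
  rw [h.graphLaw_real_plantedEvent M hι, mul_right_comm, ← hisolated, mul_comm]
  refine mul_le_mul (plantingFactor_le M N G) (measureReal_mono ?_) measureReal_nonneg
    (by positivity)
  · rintro g ⟨hg, hg'⟩
    have hremove : removeTouching I ι g = g := by
      funext e
      unfold removeTouching
      split_ifs with he
      · exact (hg e he).symm
      · rfl
    rwa [Set.mem_preimage, hremove] at hg'

theorem rootedGraphLaw_real {N : ℕ} (S : Set ((Sym2 (Fin N) → List C) × Fin N)) :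
    (M.rootedGraphLaw N).real S = (∑ r, (M.graphLaw N).real {g | (g, r) ∈ S}) / N := by
  rw [measureReal_def, PoissonEnsemble.rootedGraphLaw,
    Measure.prod_apply_symm MeasurableSet.of_discrete, lintegral_fintype,
    ENNReal.toReal_sum fun r _ => by finiteness, Finset.sum_div]
  refine Finset.sum_congr rfl fun r _ => ?_
  rw [ENNReal.toReal_mul, uniformOn_univ]
  simp [div_eq_mul_inv, measureReal_def, Set.preimage]

end GraphLaw

section Jensen

variable {Ω : Type*} [MeasurableSpace Ω] {μ : Measure Ω} {f : Ω → ℝ}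

theorem integrable_sqrt [IsFiniteMeasure μ] (hf : Integrable f μ) :
    Integrable (fun ω => √(f ω)) μ := by
  refine ((integrable_const 1).add hf.norm).mono'
    (Real.continuous_sqrt.comp_aestronglyMeasurable hf.aestronglyMeasurable)
    (ae_of_all _ fun ω => ?_)
  rw [Real.norm_of_nonneg (Real.sqrt_nonneg _), Pi.add_apply, Real.norm_eq_abs]
  exact Real.sqrt_le_iff.2 ⟨by positivity, by nlinarith [le_abs_self (f ω), abs_nonneg (f ω)]⟩

theorem integral_sqrt_le [IsProbabilityMeasure μ] (hf₀ : 0 ≤ f) (hf : Integrable f μ) :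
    ∫ ω, √(f ω) ∂μ ≤ √(∫ ω, f ω ∂μ) :=
  Real.strictConcaveOn_sqrt.concaveOn.le_map_integral Real.continuous_sqrt.continuousOn isClosed_Ici
    (ae_of_all _ hf₀) hf (integrable_sqrt hf)

theorem integral_sqrt_sqrt_le [IsProbabilityMeasure μ] (hf₀ : 0 ≤ f) (hf : Integrable f μ) :
    ∫ ω, √√(f ω) ∂μ ≤ √√(∫ ω, f ω ∂μ) :=
  (integral_sqrt_le (fun ω => Real.sqrt_nonneg (f ω)) (integrable_sqrt hf)).trans
    (Real.sqrt_le_sqrt (integral_sqrt_le hf₀ hf))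

end Jensen

section Gibbs

variable {V C X : Type*} [Fintype V] [Fintype X] (G : LabeledMultigraph V C)
  (ψ : C → Sym2 X → ℝ≥0)

theorem LabeledMultigraph.partitionFunction_nonneg : 0 ≤ G.partitionFunction ψ :=
  Finset.sum_nonneg fun x _ => G.weight_nonneg ψ x

theorem LabeledMultigraph.gibbs_nonneg (x : V → X) : 0 ≤ G.gibbs ψ x :=
  div_nonneg (G.weight_nonneg ψ x) (G.partitionFunction_nonneg ψ)

theorem LabeledMultigraph.gibbs_le_one (x : V → X) : G.gibbs ψ x ≤ 1 := by
  classical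
  refine div_le_one_of_le₀ ?_ (G.partitionFunction_nonneg ψ)
  rw [G.partitionFunction_eq_sum]
  exact Finset.single_le_sum (fun x _ => G.weight_nonneg ψ x) (Finset.mem_univ x)

variable {ψ}

theorem LabeledMultigraph.sum_gibbs [DecidableEq V] (h : 0 < G.partitionFunction ψ) :
    ∑ x, G.gibbs ψ x = 1 := by
  unfold LabeledMultigraph.gibbs
  rw [← Finset.sum_div, ← G.partitionFunction_eq_sum, div_self h.ne']

end Gibbs

section Uniformity

variable {X C T : Type*} (M : PoissonEnsemble X C)

theorem integrable_graphLaw_of_bound [Countable C] {N : ℕ} {f : (Sym2 (Fin N) → List C) → ℝ} {B : ℝ}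
    (h : ∀ g, ‖f g‖ ≤ B) : Integrable f (M.graphLaw N) :=
  .of_bound Measurable.of_discrete.aestronglyMeasurable B (ae_of_all _ h)

variable [Fintype X]

theorem defectSecondMoment_gibbs_nonneg {N : ℕ} (a : X) (g : Sym2 (Fin N) → List C) :
    0 ≤ defectSecondMoment ((multigraphOfLists N g).gibbs M.ψ) a :=
  Finset.sum_nonneg fun x₁ _ => Finset.sum_nonneg fun x₂ _ =>
    mul_nonneg (mul_nonneg (LabeledMultigraph.gibbs_nonneg _ _ x₁)
      (LabeledMultigraph.gibbs_nonneg _ _ x₂)) (sq_nonneg _)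

section Chebyshev

variable [Fintype T]

/-- The event that the model is defined and that the law of the values at the vertices `j` is at
distance at least `θ` from the uniform distribution, in the supremum norm. -/
def nonuniformEvent (θ : ℝ) {N : ℕ} (j : T → Fin N) : Set (Sym2 (Fin N) → List C) :=
  {g | 0 < (multigraphOfLists N g).partitionFunction M.ψ ∧
    ∃ ξ, θ ≤ |localMarginal ((multigraphOfLists N g).gibbs M.ψ) j ξ
      - ((Fintype.card X : ℝ)⁻¹) ^ Fintype.card T|}

variable [DecidableEq T] {θ : ℝ} (hθ : 0 < θ) {N : ℕ}
include hθ

theorem indicator_nonuniformEvent_le (j : T → Fin N) (g : Sym2 (Fin N) → List C) :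
    (nonuniformEvent M θ j).indicator 1 g
      ≤ (∑ ξ : T → X, (localMarginal ((multigraphOfLists N g).gibbs M.ψ) j ξ
          - ((Fintype.card X : ℝ)⁻¹) ^ Fintype.card T) ^ 2) / θ ^ 2 := by
  classical
  rw [Set.indicator_apply]
  split_ifs with hg
  · obtain ⟨-, ξ, hξ⟩ := hg
    rw [Pi.one_apply, one_le_div (by positivity)]
    refine le_trans ?_ (Finset.single_le_sum (fun ξ _ => sq_nonneg _) (Finset.mem_univ ξ))
    rw [← sq_abs (_ - _)]
    gcongr
  · positivity

variable [Nonempty X] [NeZero N]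

theorem average_indicator_nonuniformEvent_le (g : Sym2 (Fin N) → List C) :
    (∑ j : T → Fin N, (nonuniformEvent M θ j).indicator 1 g : ℝ) / (N : ℝ) ^ Fintype.card T
      ≤ (∑ ξ : T → X, ∑ u, (√(defectSecondMoment ((multigraphOfLists N g).gibbs M.ψ) (ξ u))
          + 4 * √√(defectSecondMoment ((multigraphOfLists N g).gibbs M.ψ) (ξ u)))) / θ ^ 2 := by
  set p := (multigraphOfLists N g).gibbs M.ψ
  by_cases hZ : 0 < (multigraphOfLists N g).partitionFunction M.ψ
  swap
  · have hzero (j : T → Fin N) : (nonuniformEvent M θ j).indicator 1 g = (0 : ℝ) :=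
      Set.indicator_of_notMem (fun hg => hZ hg.1) _
    simp only [hzero, Finset.sum_const_zero, zero_div]
    positivity
  calc _ ≤ (∑ j : T → Fin N, (∑ ξ : T → X, (localMarginal p j ξ
          - ((Fintype.card X : ℝ)⁻¹) ^ Fintype.card T) ^ 2) / θ ^ 2)
          / (N : ℝ) ^ Fintype.card T := by
        gcongr with j
        exact indicator_nonuniformEvent_le M hθ j g
    _ = (∑ ξ : T → X, (∑ j : T → Fin N, (localMarginal p j ξ
          - ((Fintype.card X : ℝ)⁻¹) ^ Fintype.card T) ^ 2) / (N : ℝ) ^ Fintype.card T)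
          / θ ^ 2 := by
        rw [← Finset.sum_div, div_right_comm, Finset.sum_comm, Finset.sum_div]
    _ ≤ _ := by
        gcongr with ξ
        exact average_localMarginal_sub_pow_sq_le (LabeledMultigraph.gibbs_nonneg _ _)
          (LabeledMultigraph.sum_gibbs _ hZ) ξ

end Chebyshev

variable [Countable C]

theorem integrable_defectSecondMoment_gibbs (N : ℕ) (a : X) : Integrable
    (fun g => defectSecondMoment ((multigraphOfLists N g).gibbs M.ψ) a) (M.graphLaw N) := by
  refine integrable_graphLaw_of_bound M (B := ∑ x₁ : Fin N → X, ∑ x₂, typeDefect x₁ x₂ a ^ 2)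
    fun g => ?_
  rw [Real.norm_of_nonneg (defectSecondMoment_gibbs_nonneg M a g)]
  refine Finset.sum_le_sum fun x₁ _ => Finset.sum_le_sum fun x₂ _ => ?_
  exact mul_le_of_le_one_left (sq_nonneg _) (mul_le_one₀ (LabeledMultigraph.gibbs_le_one _ _ _)
    (LabeledMultigraph.gibbs_nonneg _ _ _) (LabeledMultigraph.gibbs_le_one _ _ _))

variable [Fintype T] [DecidableEq T] {θ : ℝ}

theorem average_nonuniformEvent_le [Nonempty X] (hθ : 0 < θ) (N : ℕ) [NeZero N] :
    (∑ j : T → Fin N, (M.graphLaw N).real (nonuniformEvent M θ j)) / (N : ℝ) ^ Fintype.card T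
      ≤ (∑ ξ : T → X, ∑ u, (√(M.typeSecondMoment N (ξ u))
          + 4 * √√(M.typeSecondMoment N (ξ u)))) / θ ^ 2 := by
  have hindicator (j : T → Fin N) :
      Integrable ((nonuniformEvent M θ j).indicator (1 : (Sym2 (Fin N) → List C) → ℝ))
        (M.graphLaw N) :=
    (integrable_const 1).indicator .of_discrete
  have hsqrt (a : X) := integrable_sqrt (integrable_defectSecondMoment_gibbs M N a)
  have hsqrt₂ (a : X) := (integrable_sqrt (hsqrt a)).const_mul 4
  have hsum (ξ : T → X) (u : T) := (hsqrt (ξ u)).add (hsqrt₂ (ξ u))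
  have h := integral_mono ((integrable_finsetSum _ fun j _ => hindicator j).div_const _)
    ((integrable_finsetSum _ fun ξ _ => integrable_finsetSum _ fun u _ => hsum ξ u).div_const _)
    (average_indicator_nonuniformEvent_le M (T := T) hθ)
  simp only [integral_div, integral_finsetSum _ fun j _ => hindicator j,
    integral_indicator_one MeasurableSet.of_discrete] at h
  refine h.trans ?_
  gcongr
  rw [integral_finsetSum _ fun ξ _ => integrable_finsetSum _ fun u _ => hsum ξ u]
  gcongr with ξ
  rw [integral_finsetSum _ fun u _ => hsum ξ u]
  gcongr with u
  simp only [Pi.add_apply]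
  rw [integral_add (hsqrt (ξ u)) (hsqrt₂ (ξ u)), integral_const_mul]
  gcongr
  · exact integral_sqrt_le (defectSecondMoment_gibbs_nonneg M (ξ u))
      (integrable_defectSecondMoment_gibbs M N (ξ u))
  · exact integral_sqrt_sqrt_le (defectSecondMoment_gibbs_nonneg M (ξ u))
      (integrable_defectSecondMoment_gibbs M N (ξ u))

theorem tendsto_average_nonuniformEvent [Nonempty X] (hθ : 0 < θ)
    (htype : ∀ a, Tendsto (fun N => M.typeSecondMoment N a) atTop (𝓝 0)) :
    Tendsto (fun N : ℕ => (∑ j : T → Fin N, (M.graphLaw N).real (nonuniformEvent M θ j))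
      / (N : ℝ) ^ Fintype.card T) atTop (𝓝 0) := by
  have hbound (a : X) : Tendsto (fun N => √(M.typeSecondMoment N a)
      + 4 * √√(M.typeSecondMoment N a)) atTop (𝓝 0) := by
    have hcont : Continuous fun y : ℝ => √y + 4 * √√y := by fun_prop
    simpa [Function.comp_def] using (hcont.tendsto 0).comp (htype a)
  have hlim : Tendsto (fun N => (∑ ξ : T → X, ∑ u, (√(M.typeSecondMoment N (ξ u))
      + 4 * √√(M.typeSecondMoment N (ξ u)))) / θ ^ 2) atTop (𝓝 0) := by
    simpa using (tendsto_finsetSum Finset.univ fun (ξ : T → X) _ =>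
      tendsto_finsetSum Finset.univ fun u _ => hbound (ξ u)).div_const (θ ^ 2)
  refine squeeze_zero' (.of_forall fun N => by positivity) ?_ hlim
  filter_upwards [eventually_ne_atTop 0] with N hN
  have : NeZero N := ⟨hN⟩
  exact average_nonuniformEvent_le M hθ N

end Uniformity

section Nodes

variable {C : Type*}

/-- The depth of a node. -/
def nodeDepth (ω : List ℕ → List C) (ℓ : ℕ) (u : truncatedNodes ω ℓ) : ℕ := u.1.length

theorem isLayered_truncatedTree (ω : List ℕ → List C) (ℓ : ℕ) :
    IsLayered (truncatedTree ω ℓ) (treeRoot ω ℓ) (nodeDepth ω ℓ) ℓ where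
  ends_injective := by
    rintro ⟨⟨i, u⟩, h⟩ ⟨⟨j, v⟩, h'⟩ hends
    rcases Sym2.eq_iff.1 hends with ⟨rfl, hchild⟩ | ⟨hu, hv⟩
    · obtain ⟨rfl, -⟩ := List.cons.inj (congrArg Subtype.val hchild)
      rfl
    · have hu := congrArg (nodeDepth ω ℓ) hu
      have hv := congrArg (nodeDepth ω ℓ) hv
      simp only [nodeDepth, List.length_cons] at hu hv
      lia
  depth_root := rfl
  depth_le := fun u => u.2.2
  exists_parent := by
    rintro ⟨_ | ⟨i, u⟩, hu⟩
    · exact .inl rfl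
    · exact .inr ⟨⟨(i, ⟨u, parent_mem_truncatedNodes hu⟩), hu⟩,
        ⟨u, parent_mem_truncatedNodes hu⟩, rfl, rfl⟩
  edge_depth := fun ⟨⟨i, u⟩, h⟩ => ⟨u, ⟨i :: u.1, h⟩, rfl, rfl⟩

theorem card_truncatedNodes (ω : List ℕ → List C) (ℓ : ℕ) :
    Fintype.card (truncatedNodes ω ℓ) = Fintype.card (truncatedTree ω ℓ).Edge + 1 := by
  let e : truncatedNodes ω ℓ ≃ Option (truncatedTree ω ℓ).Edge :=
    { toFun
        | ⟨[], _⟩ => none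
        | ⟨i :: u, h⟩ => some ⟨(i, ⟨u, parent_mem_truncatedNodes h⟩), h⟩
      invFun
        | none => treeRoot ω ℓ
        | some k => ⟨k.1.1 :: k.1.2.1, k.2⟩
      left_inv := by rintro ⟨_ | _, _⟩ <;> rfl
      right_inv := by rintro (_ | _) <;> rfl }
  rw [Fintype.card_congr e, Fintype.card_option]

/-- The nodes which have their children in the truncated tree. -/
abbrev InnerNode (ω : List ℕ → List C) (ℓ : ℕ) := innerSet (nodeDepth ω ℓ) ℓ

variable {ω : List ℕ → List C} {ℓ : ℕ}

/-- The parent of a node; the root is its own parent. -/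
def parentNode : truncatedNodes ω ℓ → truncatedNodes ω ℓ
  | ⟨[], h⟩ => ⟨[], h⟩
  | ⟨_ :: u, h⟩ => ⟨u, parent_mem_truncatedNodes h⟩

/-- The child number `i` of an inner node. -/
def childNode (u : InnerNode ω ℓ) (i : Fin (ω u.1.1).length) : truncatedNodes ω ℓ :=
  ⟨i :: u.1.1, ⟨u.1.2.1, i.2⟩, u.2⟩

theorem childNode_injective (u : InnerNode ω ℓ) : Function.Injective (childNode u) :=
  fun _ _ hij => Fin.ext (List.cons.inj (congrArg Subtype.val hij)).1

theorem childNode_ne_parentNode (u : InnerNode ω ℓ) (i : Fin (ω u.1.1).length) :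
    childNode u i ≠ parentNode u.1 := by
  obtain ⟨⟨_ | ⟨j, u⟩, hu⟩, hℓ⟩ := u
  all_goals
    intro h
    have := congrArg (nodeDepth ω ℓ) h
    simp only [nodeDepth, childNode, parentNode, List.length_cons, List.length_nil] at this
    lia

/-- The edges of the truncated tree, listed by the node above them. -/
def edgeEquivSigma : (truncatedTree ω ℓ).Edge ≃ Σ u : InnerNode ω ℓ, Fin (ω u.1.1).length where
  toFun k := ⟨⟨k.1.2, k.2.2⟩, ⟨k.1.1, k.2.1.2⟩⟩
  invFun z := ⟨(z.2, z.1.1), (childNode z.1 z.2).2⟩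

theorem prod_label_truncatedTree [Fintype (InnerNode ω ℓ)] {R : Type*} [CommMonoid R] (f : C → R) :
    ∏ k, f ((truncatedTree ω ℓ).label k) = ∏ u : InnerNode ω ℓ, ((ω u.1.1).map f).prod :=
  calc ∏ k, f ((truncatedTree ω ℓ).label k)
      = ∏ z : Σ u : InnerNode ω ℓ, Fin (ω u.1.1).length, f ((ω z.1.1.1).get z.2) :=
        Fintype.prod_equiv edgeEquivSigma _ _ fun _ => rfl
    _ = _ := by simp only [Fintype.prod_sigma, List.get_eq_getElem, Fin.prod_univ_fun_getElem]

end Nodes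

section Increasing

variable {C α : Type*} {ω : List ℕ → List C} {ℓ : ℕ}

/-- An injective map of the nodes which respects the order of siblings. -/
structure IsIncreasing [Preorder α] (ι : truncatedNodes ω ℓ → α) : Prop where
  injective : Function.Injective ι
  strictMono : ∀ u : InnerNode ω ℓ, StrictMono fun i => ι (childNode u i)

/-- The map of the nodes that moves the child number `i` of a node `u` to its child number
`σ u i`. It does not move the descendants along, so it is not an automorphism of the tree. -/
def permuteSiblings (σ : ∀ u : InnerNode ω ℓ, Equiv.Perm (Fin (ω u.1.1).length)) :
    truncatedNodes ω ℓ → truncatedNodes ω ℓ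
  | ⟨[], h⟩ => ⟨[], h⟩
  | ⟨i :: u, h⟩ => childNode (⟨⟨u, parent_mem_truncatedNodes h⟩, h.2⟩ : InnerNode ω ℓ)
      (σ ⟨⟨u, parent_mem_truncatedNodes h⟩, h.2⟩ ⟨i, h.1.2⟩)

theorem permuteSiblings_childNode (σ : ∀ u : InnerNode ω ℓ, Equiv.Perm (Fin (ω u.1.1).length))
    (u : InnerNode ω ℓ) (i : Fin (ω u.1.1).length) :
    permuteSiblings σ (childNode u i) = childNode u (σ u i) := rfl

theorem permuteSiblings_surjective
    (σ : ∀ u : InnerNode ω ℓ, Equiv.Perm (Fin (ω u.1.1).length)) :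
    Function.Surjective (permuteSiblings σ) := by
  rintro ⟨_ | ⟨i, u⟩, hv⟩
  · exact ⟨⟨[], hv⟩, rfl⟩
  · let v : InnerNode ω ℓ := ⟨⟨u, parent_mem_truncatedNodes hv⟩, hv.2⟩
    refine ⟨childNode v ((σ v).symm ⟨i, hv.1.2⟩), ?_⟩
    rw [permuteSiblings_childNode, Equiv.apply_symm_apply]
    rfl

theorem isIncreasing_comp_permuteSiblings_sort [LinearOrder α] {ι : truncatedNodes ω ℓ → α}
    (hι : Function.Injective ι) :
    IsIncreasing (ι ∘ permuteSiblings fun u => Tuple.sort fun i => ι (childNode u i)) where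
  injective := hι.comp (Finite.injective_iff_surjective.2 (permuteSiblings_surjective _))
  strictMono u := (Tuple.monotone_sort fun i => ι (childNode u i)).strictMono_of_injective
    ((hι.comp (childNode_injective u)).comp (Equiv.injective _))

-- Sorting the siblings maps an embedding to an increasing one and a family of permutations.
theorem descFactorial_le_card_isIncreasing [Fintype α] [LinearOrder α]
    [Fintype (InnerNode ω ℓ)] [Fintype {ι : truncatedNodes ω ℓ → α // IsIncreasing ι}] :
    (Fintype.card α).descFactorial (Fintype.card (truncatedNodes ω ℓ))
      ≤ Fintype.card {ι : truncatedNodes ω ℓ → α // IsIncreasing ι}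
        * ∏ u : InnerNode ω ℓ, ((ω u.1.1).length).factorial := by
  classical
  have hperm : ∏ u : InnerNode ω ℓ, ((ω u.1.1).length).factorial
      = Fintype.card (∀ u : InnerNode ω ℓ, Equiv.Perm (Fin (ω u.1.1).length)) := by
    simp only [Fintype.card_pi, Fintype.card_perm, Fintype.card_fin]
  rw [hperm, ← Fintype.card_embedding_eq, ← Fintype.card_prod]
  refine Fintype.card_le_of_injective (fun ι : truncatedNodes ω ℓ ↪ α =>
    (⟨_, isIncreasing_comp_permuteSiblings_sort ι.injective⟩,
      fun u => Tuple.sort fun i => ι (childNode u i))) fun ι ι' h => ?_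
  simp only [Prod.mk.injEq, Subtype.mk.injEq] at h
  obtain ⟨hcomp, hsort⟩ := h
  rw [hsort] at hcomp
  exact DFunLike.coe_injective ((permuteSiblings_surjective _).injective_comp_right hcomp)

end Increasing

section Unique

theorem strictMono_fin_unique {α : Type*} [LinearOrder α] {k k' : ℕ} {f : Fin k → α}
    {f' : Fin k' → α} (hf : StrictMono f) (hf' : StrictMono f') (h : Set.range f = Set.range f') :
    ∃ hk : k = k', ∀ i, f i = f' (Fin.cast hk i) := by
  have hk : k = k' := by
    simpa [Set.ncard_range_of_injective, hf.injective, hf'.injective] using congrArg Set.ncard h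
  subst hk
  exact ⟨rfl, congrFun ((hf.range_inj hf').1 h)⟩

/-- The event that the truncated tree is planted. -/
abbrev plantedTreeEvent {C V : Type*} (ω : List ℕ → List C) (ℓ : ℕ)
    (ι : truncatedNodes ω ℓ → V) : Set (Sym2 V → List C) :=
  plantedEvent (truncatedTree ω ℓ) (innerSet (nodeDepth ω ℓ) ℓ) ι

variable {C V : Type*} {g : Sym2 V → List C} {ω ω' : List ℕ → List C} {ℓ : ℕ}
  {ι : truncatedNodes ω ℓ → V} {ι' : truncatedNodes ω' ℓ → V}

theorem planted_child_label (hι : Function.Injective ι) (hg : g ∈ plantedTreeEvent ω ℓ ι)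
    (u : InnerNode ω ℓ) (i : Fin (ω u.1.1).length) :
    g s(ι u, ι (childNode u i)) = [(ω u.1.1)[i]] := by
  have hlayered := isLayered_truncatedTree ω ℓ
  let k := edgeEquivSigma.symm ⟨u, i⟩
  exact (hg _ (hlayered.map_ends_mem_touching ι k)).trans
    (plantedLists_map_ends hlayered.ends_injective hι k)

theorem range_planted_childNode (hι : Function.Injective ι) (hg : g ∈ plantedTreeEvent ω ℓ ι)
    (u : InnerNode ω ℓ) :
    Set.range (fun i => ι (childNode u i))
      = {w | g s(ι u, w) ≠ [] ∧ w ≠ ι (parentNode u.1)} := by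
  refine Set.Subset.antisymm ?_ ?_
  · rintro _ ⟨i, rfl⟩
    refine ⟨?_, hι.ne (childNode_ne_parentNode u i)⟩
    rw [planted_child_label hι hg]
    exact List.cons_ne_nil _ _
  · rintro w ⟨hne, hparent⟩
    rw [hg _ ⟨u, u.2, Sym2.mem_mk_left _ _⟩] at hne
    obtain ⟨⟨⟨i, p⟩, hk⟩, hends⟩ := not_imp_comm.1 plantedLists_of_notMem_range hne
    rcases Sym2.eq_iff.1 hends with ⟨hu, rfl⟩ | ⟨rfl, hu⟩
    · obtain rfl := hι hu
      exact ⟨⟨i, hk.1.2⟩, rfl⟩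
    · exact absurd (congrArg (ι ∘ parentNode) (hι hu)) hparent

variable [LinearOrder V] (hι : IsIncreasing ι) (hι' : IsIncreasing ι')
  (hg : g ∈ plantedTreeEvent ω ℓ ι) (hg' : g ∈ plantedTreeEvent ω' ℓ ι')
include hι hι' hg hg'

theorem planted_children_unique (u : InnerNode ω ℓ) (u' : InnerNode ω' ℓ) (hu : ι u = ι' u')
    (hparent : ι (parentNode u.1) = ι' (parentNode u'.1)) :
    ∃ h : ω u.1.1 = ω' u'.1.1, ∀ i, ι (childNode u i) = ι' (childNode u' (i.cast (by rw [h]))) := by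
  have hrange : Set.range (fun i => ι (childNode u i))
      = Set.range fun i => ι' (childNode u' i) := by
    rw [range_planted_childNode hι.injective hg, range_planted_childNode hι'.injective hg', hu,
      hparent]
  obtain ⟨hlength, hchild⟩ := strictMono_fin_unique (hι.strictMono u) (hι'.strictMono u') hrange
  refine ⟨List.ext_getElem hlength fun i hi _ => ?_, hchild⟩
  have hlabel := planted_child_label hι.injective hg u ⟨i, hi⟩
  rw [hu, hchild, planted_child_label hι'.injective hg' u'] at hlabel
  exact (List.singleton_inj.1 hlabel).symm

variable (hroot : ι (treeRoot ω ℓ) = ι' (treeRoot ω' ℓ))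
include hroot

theorem planted_node_unique (u : List ℕ) (hu : u ∈ truncatedNodes ω ℓ) :
    ∃ hu' : u ∈ truncatedNodes ω' ℓ, ι ⟨u, hu⟩ = ι' ⟨u, hu'⟩ ∧
      ι (parentNode ⟨u, hu⟩) = ι' (parentNode ⟨u, hu'⟩) := by
  induction u with
  | nil => exact ⟨nil_mem_truncatedNodes ω' ℓ, hroot, hroot⟩
  | cons i u ih =>
    have hp := parent_mem_truncatedNodes hu
    obtain ⟨hp', hnode, hparent⟩ := ih hp
    obtain ⟨hω, hchild⟩ := planted_children_unique hι hι' hg hg' ⟨⟨u, hp⟩, hu.2⟩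
      ⟨⟨u, hp'⟩, hu.2⟩ hnode hparent
    exact ⟨⟨⟨hp'.1, hω ▸ hu.1.2⟩, hu.2⟩, hchild ⟨i, hu.1.2⟩, hnode⟩

theorem planted_label_unique (u : List ℕ) (hu : u ∈ truncatedNodes ω ℓ) (hℓ : u.length < ℓ) :
    ω' u = ω u := by
  obtain ⟨hu', hnode, hparent⟩ := planted_node_unique hι hι' hg hg' hroot u hu
  exact (planted_children_unique hι hι' hg hg' ⟨⟨u, hu⟩, hℓ⟩ ⟨⟨u, hu'⟩, hℓ⟩ hnode hparent).1.symm

end Unique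

section Words

variable {C : Type*} {ω ω' : List ℕ → List C} {ℓ : ℕ}

/-- The words of the inner nodes of the truncated tree. -/
noncomputable def innerWords (ω : List ℕ → List C) (ℓ : ℕ) : Finset (List ℕ) :=
  (truncatedNodes_finite ω ℓ).toFinset.filter fun u => u.length < ℓ

theorem mem_innerWords {u : List ℕ} :
    u ∈ innerWords ω ℓ ↔ u ∈ truncatedNodes ω ℓ ∧ u.length < ℓ := by
  rw [innerWords, Finset.mem_filter, Set.Finite.mem_toFinset]

/-- The event that the random tree and the tree described by `ω` have the same truncation. -/
def treeCylinder (ω : List ℕ → List C) (ℓ : ℕ) : Set (List ℕ → List C) :=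
  (innerWords ω ℓ : Set (List ℕ)).pi fun u => {ω u}

theorem truncatedNodes_eq_of_mem_treeCylinder (h : ω' ∈ treeCylinder ω ℓ) :
    truncatedNodes ω' ℓ = truncatedNodes ω ℓ := by
  ext u
  induction u with
  | nil => exact iff_of_true (nil_mem_truncatedNodes ω' ℓ) (nil_mem_truncatedNodes ω ℓ)
  | cons i u ih =>
    constructor <;> intro hu <;> have hp := parent_mem_truncatedNodes hu
    · exact ⟨⟨(ih.1 hp).1, h u (mem_innerWords.2 ⟨ih.1 hp, hu.2⟩) ▸ hu.1.2⟩, hu.2⟩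
    · exact ⟨⟨(ih.2 hp).1, (h u (mem_innerWords.2 ⟨hp, hu.2⟩)).symm ▸ hu.1.2⟩, hu.2⟩

/-- The inner nodes together with their lists of labels, a datum which encodes the truncated
tree and which ranges over a countable type. -/
noncomputable def treeCode (ω : List ℕ → List C) (ℓ : ℕ) : Finset (List ℕ × List C) :=
  (innerWords ω ℓ).map ⟨fun u => (u, ω u), fun _ _ h => congrArg Prod.fst h⟩

theorem mem_treeCode {u : List ℕ} {l : List C} :
    (u, l) ∈ treeCode ω ℓ ↔ u ∈ innerWords ω ℓ ∧ l = ω u := by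
  refine Finset.mem_map.trans ⟨?_, fun h => ⟨u, h.1, Prod.ext rfl h.2.symm⟩⟩
  rintro ⟨_, hu, h⟩
  cases h
  exact ⟨hu, rfl⟩

theorem treeCode_eq_iff : treeCode ω' ℓ = treeCode ω ℓ ↔ ω' ∈ treeCylinder ω ℓ := by
  refine ⟨fun h u hu => ?_, fun h => ?_⟩
  · have hcode : (u, ω u) ∈ treeCode ω' ℓ := h ▸ mem_treeCode.2 ⟨hu, rfl⟩
    exact (mem_treeCode.1 hcode).2.symm
  · ext ⟨u, l⟩
    rw [mem_treeCode, mem_treeCode, mem_innerWords, mem_innerWords,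
      truncatedNodes_eq_of_mem_treeCylinder h]
    refine and_congr_right fun hu => ?_
    rw [h u (mem_innerWords.2 hu)]

section Increasing

variable {V : Type*} [LinearOrder V] {g : Sym2 V → List C}

theorem IsIncreasing.treeCode_eq {ι : truncatedNodes ω ℓ → V} {ι' : truncatedNodes ω' ℓ → V}
    (hι : IsIncreasing ι) (hι' : IsIncreasing ι') (hg : g ∈ plantedTreeEvent ω ℓ ι)
    (hg' : g ∈ plantedTreeEvent ω' ℓ ι') (hroot : ι (treeRoot ω ℓ) = ι' (treeRoot ω' ℓ)) :
    treeCode ω ℓ = treeCode ω' ℓ := by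
  refine (treeCode_eq_iff.2 fun u hu => ?_).symm
  obtain ⟨hu, hℓ⟩ := mem_innerWords.1 hu
  exact planted_label_unique hι hι' hg hg' hroot u hu hℓ

theorem IsIncreasing.eq_of_root_eq {ι ι' : truncatedNodes ω ℓ → V} (hι : IsIncreasing ι)
    (hι' : IsIncreasing ι') (hg : g ∈ plantedTreeEvent ω ℓ ι) (hg' : g ∈ plantedTreeEvent ω ℓ ι')
    (hroot : ι (treeRoot ω ℓ) = ι' (treeRoot ω ℓ)) : ι = ι' :=
  funext fun u => (planted_node_unique hι hι' hg hg' hroot u.1 u.2).2.1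

end Increasing

section Correlation

/-- The multigraph whose edges join the elements of a finite set of words to their children. The
truncated tree is of this form with a set of words which can be substituted. -/
noncomputable def wordGraph (S : Set (List ℕ)) (hS : S.Finite)
    (label : {e : ℕ × S // e.1 :: e.2.1 ∈ S} → C) : LabeledMultigraph S C where
  Edge := {e : ℕ × S // e.1 :: e.2.1 ∈ S}
  edgeFintype := by
    have := hS.to_subtype
    refine @Fintype.ofFinite _ (Finite.of_injective (β := S) (fun e => ⟨e.1.1 :: e.1.2.1, e.2⟩) ?_)
    rintro ⟨⟨i, u, hu⟩, h⟩ ⟨⟨j, v, hv⟩, h'⟩ hij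
    obtain ⟨rfl, rfl⟩ := List.cons.inj (congrArg Subtype.val hij)
    rfl
  ends e := s(e.1.2, ⟨e.1.1 :: e.1.2.1, e.2⟩)
  label := label

variable {X : Type*} [Fintype X] (ψ : C → Sym2 X → ℝ≥0)

theorem rootCorrelation_wordGraph_congr {S S' : Set (List ℕ)} [Fintype S] [Fintype S']
    (hSS' : S = S') (hS : S.Finite) (hS' : S'.Finite) (hroot : [] ∈ S) (hroot' : [] ∈ S')
    {label : {e : ℕ × S // e.1 :: e.2.1 ∈ S} → C}
    {label' : {e : ℕ × S' // e.1 :: e.2.1 ∈ S'} → C}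
    (hlabel : ∀ i u hu hu' hi hi', label ⟨(i, ⟨u, hu⟩), hi⟩ = label' ⟨(i, ⟨u, hu'⟩), hi'⟩)
    (t : ℕ) :
    (wordGraph S hS label).rootCorrelation ψ ⟨[], hroot⟩ t
      = (wordGraph S' hS' label').rootCorrelation ψ ⟨[], hroot'⟩ t := by
  subst hSS'
  obtain rfl : label = label' := funext fun ⟨⟨i, u, hu⟩, hi⟩ => hlabel i u hu hu hi hi
  congr!

theorem rootCorrelation_eq_of_mem_treeCylinder (h : ω' ∈ treeCylinder ω ℓ) (t : ℕ) :
    (truncatedTree ω' ℓ).rootCorrelation ψ (treeRoot ω' ℓ) t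
      = (truncatedTree ω ℓ).rootCorrelation ψ (treeRoot ω ℓ) t := by
  refine rootCorrelation_wordGraph_congr ψ (truncatedNodes_eq_of_mem_treeCylinder h)
    (truncatedNodes_finite _ _) (truncatedNodes_finite _ _) (nil_mem_truncatedNodes _ _)
    (nil_mem_truncatedNodes _ _) (label := fun e => (ω' e.1.2.1).get ⟨e.1.1, e.2.1.2⟩)
    (label' := fun e => (ω e.1.2.1).get ⟨e.1.1, e.2.1.2⟩) (fun i u _ hu _ hi => ?_) t
  have hω : ω' u = ω u := h u (mem_innerWords.2 ⟨hu, hi.2⟩)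
  simp only [List.get_eq_getElem, hω]

end Correlation

section Law

variable {X : Type*} (M : PoissonEnsemble X C)

instance isProbabilityMeasure_treeLaw : IsProbabilityMeasure M.treeLaw := by
  unfold PoissonEnsemble.treeLaw
  infer_instance

theorem measurableSet_treeCylinder (ω : List ℕ → List C) (ℓ : ℕ) :
    MeasurableSet (treeCylinder ω ℓ) :=
  MeasurableSet.pi (Finset.countable_toSet _) fun _ _ => measurableSet_singleton _

theorem treeLaw_real_treeCylinder (ω : List ℕ → List C) (ℓ : ℕ) [Fintype (InnerNode ω ℓ)] :
    M.treeLaw.real (treeCylinder ω ℓ)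
      = ∏ u : InnerNode ω ℓ, (poissonList (2 * M.γ) M.p).toMeasure.real {ω u.1.1} := by
  rw [measureReal_def, PoissonEnsemble.treeLaw, treeCylinder,
    Measure.infinitePi_pi _ fun _ _ => measurableSet_singleton _, ENNReal.toReal_prod]
  refine (Finset.prod_bij (fun u _ => u.1.1) (fun u _ => mem_innerWords.2 ⟨u.1.2, u.2⟩)
    (fun u _ v _ huv => Subtype.ext (Subtype.ext huv)) (fun u hu => ?_) fun _ _ => rfl).symm
  obtain ⟨hu, hℓ⟩ := mem_innerWords.1 hu
  exact ⟨⟨⟨u, hu⟩, hℓ⟩, Finset.mem_univ _, rfl⟩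

end Law

end Words

section PositiveProbability

variable {Ω : ℕ → Type*} [∀ n, MeasurableSpace (Ω n)] {μ : ∀ n, Measure (Ω n)}
  [∀ n, IsFiniteMeasure (μ n)] {A : ∀ n, Set (Ω n)}

theorem withPositiveProbability_iff : WithPositiveProbability (fun n => μ n (A n)) ↔
    ∃ δ : ℝ, 0 < δ ∧ ∃ᶠ n in atTop, δ ≤ (μ n).real (A n) := by
  refine ⟨fun ⟨δ, hδ, h⟩ => ?_, fun ⟨δ, hδ, h⟩ => ⟨.ofReal δ, ENNReal.ofReal_pos.2 hδ,
    h.mono fun n hn => (ENNReal.ofReal_le_iff_le_toReal (measure_ne_top _ _)).2 hn⟩⟩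
  obtain ⟨n, hn⟩ := h.exists
  exact ⟨δ.toReal, ENNReal.toReal_pos hδ.ne' (ne_top_of_le_ne_top (measure_ne_top _ _) hn),
    h.mono fun n hn => ENNReal.toReal_mono (measure_ne_top _ _) hn⟩

end PositiveProbability

section TreeApproximation

variable {X C : Type*} [Countable C] (M : PoissonEnsemble X C)

theorem exists_finset_treeLaw_lt_sum {ℓ : ℕ} {S : Set (List ℕ → List C)}
    (hS : ∀ ω ∈ S, treeCylinder ω ℓ ⊆ S) {σ : ℝ} (hσ : σ < M.treeLaw.real S) :
    ∃ F : Finset (List ℕ → List C), ↑F ⊆ S ∧ Set.InjOn (treeCode · ℓ) (F : Set (List ℕ → List C)) ∧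
      σ < ∑ ω ∈ F, M.treeLaw.real (treeCylinder ω ℓ) := by
  obtain ⟨R, hRS, hbij⟩ := Set.exists_subset_bijOn S (treeCode · ℓ)
  have : Countable R := hbij.mapsTo.countable_of_injOn hbij.injOn (Set.to_countable _)
  have hunion : S = ⋃ ω : R, treeCylinder ω.1 ℓ := by
    refine Set.Subset.antisymm (fun ω hω => ?_) (Set.iUnion_subset fun ω => hS _ (hRS ω.2))
    obtain ⟨ω', hω', hcode⟩ := hbij.surjOn ⟨ω, hω, rfl⟩
    exact Set.mem_iUnion.2 ⟨⟨ω', hω'⟩, treeCode_eq_iff.1 hcode.symm⟩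
  have hdisjoint : Pairwise (Function.onFun Disjoint fun ω : R => treeCylinder ω.1 ℓ) := by
    refine fun ω ω' hne => Set.disjoint_left.2 fun _ h h' => hne (Subtype.ext ?_)
    exact hbij.injOn ω.2 ω'.2 ((treeCode_eq_iff.2 h).symm.trans (treeCode_eq_iff.2 h'))
  have hmeasure := measure_iUnion (μ := M.treeLaw) hdisjoint
    fun ω => measurableSet_treeCylinder ω.1 ℓ
  rw [← hunion] at hmeasure
  have hsum : HasSum (fun ω : R => M.treeLaw.real (treeCylinder ω.1 ℓ)) (M.treeLaw.real S) := by
    rw [measureReal_def, hmeasure, ENNReal.tsum_toReal_eq fun _ => measure_ne_top _ _]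
    exact ENNReal.hasSum_toReal (hmeasure ▸ measure_ne_top _ _)
  obtain ⟨F, hF⟩ := (hsum.eventually (lt_mem_nhds hσ)).exists
  have hFR : ↑(F.map (.subtype (· ∈ R))) ⊆ R := by simp
  refine ⟨F.map (.subtype (· ∈ R)), hFR.trans hRS, hbij.injOn.mono hFR, ?_⟩
  rwa [Finset.sum_map]

end TreeApproximation

section Matching

variable {X C : Type*} (M : PoissonEnsemble X C) (ω : List ℕ → List C) (ℓ : ℕ)

/-- The event that the truncated tree is planted at the root by an increasing map `ι`, and that
the multigraph left when the edges of this tree are removed lies in `B ι`. -/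
def matchedEvent {N : ℕ} (B : (truncatedNodes ω ℓ → Fin N) → Set (Sym2 (Fin N) → List C)) :
    Set ((Sym2 (Fin N) → List C) × Fin N) :=
  {z | ∃ ι, IsIncreasing ι ∧ ι (treeRoot ω ℓ) = z.2 ∧ z.1 ∈ plantedTreeEvent ω ℓ ι ∧
    removeTouching (innerSet (nodeDepth ω ℓ) ℓ) ι z.1 ∈ B ι}

theorem treeLaw_real_treeCylinder_mul_prod_factorial [Fintype (InnerNode ω ℓ)] :
    M.treeLaw.real (treeCylinder ω ℓ) * ∏ u : InnerNode ω ℓ, ((ω u.1.1).length.factorial : ℝ)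
      = Real.exp (-(2 * M.γ)) ^ (InnerNode ω ℓ).ncard
        * ∏ k, (2 * M.γ * (M.p ((truncatedTree ω ℓ).label k)).toReal : ℝ) := by
  rw [treeLaw_real_treeCylinder, ← Nat.card_coe_set_eq, Nat.card_eq_fintype_card,
    prod_label_truncatedTree fun a => (2 * M.γ * (M.p a).toReal : ℝ), ← Finset.card_univ,
    ← Finset.prod_const, ← Finset.prod_mul_distrib, ← Finset.prod_mul_distrib]
  refine Finset.prod_congr rfl fun u _ => ?_
  rw [poissonList_real_singleton, List.prod_map_mul, List.map_const', List.prod_replicate]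
  push_cast
  field_simp

variable {ω ℓ}

theorem treeLaw_mul_prod_factorial_le_graphLaw [Fintype (InnerNode ω ℓ)] {N : ℕ} (hN : N ≠ 0)
    {ι : truncatedNodes ω ℓ → Fin N} (hι : ι.Injective) :
    M.treeLaw.real (treeCylinder ω ℓ) * ∏ u : InnerNode ω ℓ, ((ω u.1.1).length.factorial : ℝ)
      ≤ (M.graphLaw N).real (plantedTreeEvent ω ℓ ι)
        * (N : ℝ) ^ Fintype.card (truncatedTree ω ℓ).Edge := by
  rw [treeLaw_real_treeCylinder_mul_prod_factorial,
    (isLayered_truncatedTree ω ℓ).graphLaw_real_plantedEvent M hι, mul_assoc,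
    plantingFactor_mul_pow M hN]
  gcongr
  exact exp_neg_le_graphLaw_real_isolatedEvent M hN (Set.toFinite _) ι

theorem disjoint_matchedEvent {ω' : List ℕ → List C} (h : treeCode ω ℓ ≠ treeCode ω' ℓ) {N : ℕ}
    (B : (truncatedNodes ω ℓ → Fin N) → Set (Sym2 (Fin N) → List C))
    (B' : (truncatedNodes ω' ℓ → Fin N) → Set (Sym2 (Fin N) → List C)) :
    Disjoint (matchedEvent ω ℓ B) (matchedEvent ω' ℓ B') := by
  refine Set.disjoint_left.2 ?_
  rintro _ ⟨ι, hι, hroot, hg, -⟩ ⟨ι', hι', hroot', hg', -⟩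
  exact h (hι.treeCode_eq hι' hg hg' (hroot.trans hroot'.symm))

instance isFiniteMeasure_rootedGraphLaw (N : ℕ) : IsFiniteMeasure (M.rootedGraphLaw N) := by
  unfold PoissonEnsemble.rootedGraphLaw uniformOn
  infer_instance

instance isProbabilityMeasure_rootedGraphLaw (N : ℕ) [NeZero N] :
    IsProbabilityMeasure (M.rootedGraphLaw N) := by
  unfold PoissonEnsemble.rootedGraphLaw
  infer_instance

variable [Countable C]

theorem rootedGraphLaw_real_matchedEvent {N : ℕ}
    [DecidablePred fun ι : truncatedNodes ω ℓ → Fin N => IsIncreasing ι]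
    (B : (truncatedNodes ω ℓ → Fin N) → Set (Sym2 (Fin N) → List C)) :
    (M.rootedGraphLaw N).real (matchedEvent ω ℓ B)
      = (∑ ι : truncatedNodes ω ℓ → Fin N with IsIncreasing ι,
          (M.graphLaw N).real (plantedTreeEvent ω ℓ ι)
            * (M.graphLaw N).real (removeTouching (innerSet (nodeDepth ω ℓ) ℓ) ι ⁻¹' B ι))
        / N := by
  rw [rootedGraphLaw_real, ← Finset.sum_fiberwise
    (g := fun ι : truncatedNodes ω ℓ → Fin N => ι (treeRoot ω ℓ))]
  congr 1
  refine Finset.sum_congr rfl fun r _ => ?_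
  simp only [plantedTreeEvent, plantedEvent, ← graphLaw_real_inter_removeTouching]
  rw [← measureReal_biUnion_finset _ fun _ _ => MeasurableSet.of_discrete]
  · congr 1
    ext g
    simp only [matchedEvent, Set.mem_ofPred_eq, Set.mem_iUnion, Finset.mem_filter, Finset.mem_univ,
      true_and, exists_prop, and_assoc]
    rfl
  · intro ι hι ι' hι' hne
    simp only [Finset.coe_filter, Finset.mem_filter, Finset.mem_univ, true_and,
      Set.mem_ofPred_eq] at hι hι'
    exact Set.disjoint_left.2 fun g hg hg' =>
      hne (hι.1.eq_of_root_eq hι'.1 hg.1 hg'.1 (hι.2.trans hι'.2.symm))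

theorem treeLaw_mul_descFactorial_le {N : ℕ} (hN : N ≠ 0) :
    M.treeLaw.real (treeCylinder ω ℓ) * ((N.descFactorial (Fintype.card (truncatedNodes ω ℓ)) : ℝ)
        / (N : ℝ) ^ Fintype.card (truncatedNodes ω ℓ))
      ≤ (M.rootedGraphLaw N).real (matchedEvent ω ℓ fun _ => Set.univ) := by
  classical
  set τ := M.treeLaw.real (treeCylinder ω ℓ)
  set D : ℝ := ∏ u : InnerNode ω ℓ, ((ω u.1.1).length.factorial : ℝ)
  set E := Fintype.card (truncatedTree ω ℓ).Edge with hE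
  set increasing : Finset (truncatedNodes ω ℓ → Fin N) := {ι | IsIncreasing ι}
  have hcard : (N.descFactorial (E + 1) : ℝ) ≤ increasing.card * D := by
    have h := Nat.cast_le (α := ℝ).2
      (descFactorial_le_card_isIncreasing (ω := ω) (ℓ := ℓ) (α := Fin N))
    rwa [Fintype.card_fin, card_truncatedNodes, Fintype.card_subtype, Nat.cast_mul,
      Nat.cast_prod] at h
  rw [card_truncatedNodes, rootedGraphLaw_real_matchedEvent]
  calc τ * (N.descFactorial (E + 1) / (N : ℝ) ^ (E + 1))
      ≤ τ * (increasing.card * D / (N : ℝ) ^ (E + 1)) := by gcongr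
    _ = (∑ _ι ∈ increasing, τ * D / (N : ℝ) ^ E) / N := by
        rw [Finset.sum_const, nsmul_eq_mul, pow_succ]
        field_simp
    _ ≤ (∑ ι ∈ increasing, (M.graphLaw N).real (plantedTreeEvent ω ℓ ι)) / N := by
        gcongr with ι hι
        rw [div_le_iff₀ (by positivity)]
        exact treeLaw_mul_prod_factorial_le_graphLaw M hN (Finset.mem_filter.1 hι).2.injective
    _ = _ := by simp only [Set.preimage_univ, probReal_univ, mul_one, increasing]

theorem tendsto_descFactorial_div_pow (n : ℕ) :
    Tendsto (fun N : ℕ => (N.descFactorial n : ℝ) / (N : ℝ) ^ n) atTop (𝓝 1) := by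
  refine (Asymptotics.isEquivalent_iff_tendsto_one ?_).1 (isEquivalent_descFactorial n)
  filter_upwards [eventually_ne_atTop 0] with N hN
  simp [hN]

theorem eventually_lt_rootedGraphLaw_real_matchedEvent {F : Finset (List ℕ → List C)}
    (hF : Set.InjOn (treeCode · ℓ) (F : Set (List ℕ → List C))) {σ : ℝ}
    (hσ : σ < ∑ ω ∈ F, M.treeLaw.real (treeCylinder ω ℓ)) :
    ∀ᶠ N in atTop, σ < (M.rootedGraphLaw N).real (⋃ ω ∈ F, matchedEvent ω ℓ fun _ => Set.univ) := by
  have hlim : Tendsto (fun N : ℕ => ∑ ω ∈ F, M.treeLaw.real (treeCylinder ω ℓ)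
      * ((N.descFactorial (Fintype.card (truncatedNodes ω ℓ)) : ℝ)
        / (N : ℝ) ^ Fintype.card (truncatedNodes ω ℓ))) atTop
      (𝓝 (∑ ω ∈ F, M.treeLaw.real (treeCylinder ω ℓ) * 1)) :=
    tendsto_finsetSum _ fun ω _ => (tendsto_descFactorial_div_pow _).const_mul _
  simp only [mul_one] at hlim
  filter_upwards [hlim.eventually (lt_mem_nhds hσ), eventually_ne_atTop 0] with N hN hN0
  rw [measureReal_biUnion_finset (fun ω hω ω' hω' hne =>
    disjoint_matchedEvent (hF.ne hω hω' hne) _ _) fun _ _ => MeasurableSet.of_discrete]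
  exact hN.trans_le (Finset.sum_le_sum fun ω _ => treeLaw_mul_descFactorial_le M hN0)

theorem tendsto_rootedGraphLaw_matchedEvent_nonuniformEvent [Fintype X] [Nonempty X] {θ : ℝ}
    (hθ : 0 < θ) (htype : ∀ a, Tendsto (fun N => M.typeSecondMoment N a) atTop (𝓝 0)) :
    Tendsto (fun N => (M.rootedGraphLaw N).real (matchedEvent ω ℓ (nonuniformEvent M θ)))
      atTop (𝓝 0) := by
  classical
  set E := Fintype.card (truncatedTree ω ℓ).Edge with hE
  have hlim := (tendsto_average_nonuniformEvent (T := truncatedNodes ω ℓ) M hθ htype).const_mul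
    ((2 * M.γ : ℝ) ^ E)
  rw [mul_zero] at hlim
  refine squeeze_zero' (.of_forall fun N => measureReal_nonneg) ?_ hlim
  filter_upwards [eventually_ne_atTop 0] with N hN
  rw [card_truncatedNodes, ← hE, rootedGraphLaw_real_matchedEvent]
  calc _ ≤ (∑ ι : truncatedNodes ω ℓ → Fin N with IsIncreasing ι,
        (2 * M.γ / N : ℝ) ^ E * (M.graphLaw N).real (nonuniformEvent M θ ι)) / N := by
        refine div_le_div_of_nonneg_right (Finset.sum_le_sum fun ι hι => ?_) N.cast_nonneg
        exact (isLayered_truncatedTree ω ℓ).graphLaw_real_plantedEvent_mul_le M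
          (Finset.mem_filter.1 hι).2.injective (nonuniformEvent M θ ι)
    _ ≤ (∑ ι : truncatedNodes ω ℓ → Fin N,
        (2 * M.γ / N : ℝ) ^ E * (M.graphLaw N).real (nonuniformEvent M θ ι)) / N := by
        gcongr
        exact Finset.filter_subset _ _
    _ = _ := by
        rw [← Finset.mul_sum, div_pow, pow_succ]
        field_simp

end Matching

section Comparison

variable {X C : Type*} [Fintype X] (M : PoissonEnsemble X C)

/-- The event that the graphical model on the random multigraph is defined. -/
def definedEvent (N : ℕ) : Set (Sym2 (Fin N) → List C) :=
  {g | 0 < (multigraphOfLists N g).partitionFunction M.ψ}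

theorem partitionFunction_pos_of_rootCorrelation_pos {V : Type*} [Fintype V]
    {G : LabeledMultigraph V C} {ψ : C → Sym2 X → ℝ≥0} {r : V} {t : ℕ}
    (h : 0 < G.rootCorrelation ψ r t) : 0 < G.partitionFunction ψ := by
  refine (G.partitionFunction_nonneg ψ).lt_of_ne' fun hZ => h.ne' ?_
  simp [LabeledMultigraph.rootCorrelation, LabeledMultigraph.jointMarginal,
    LabeledMultigraph.rootMarginal, LabeledMultigraph.gibbs, hZ]

theorem nonempty_of_frequently_definedEvent {δ : ℝ} (hδ : 0 < δ)
    (hdefined : ∃ᶠ N in atTop, δ ≤ (M.graphLaw N).real (definedEvent M N)) : Nonempty X := by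
  obtain ⟨N, hN, hN0⟩ := (hdefined.and_eventually (eventually_ne_atTop 0)).exists
  have : NeZero N := ⟨hN0⟩
  obtain ⟨g, hg⟩ := nonempty_of_measureReal_ne_zero (hδ.trans_le hN).ne'
  rw [definedEvent, Set.mem_ofPred_eq, LabeledMultigraph.partitionFunction_eq_sum] at hg
  obtain ⟨x, -, -⟩ := Finset.exists_ne_zero_of_sum_ne_zero hg.ne'
  exact ⟨x 0⟩

variable {ω : List ℕ → List C} {t ℓ : ℕ}

theorem exists_rootCorrelation_near_of_mem_matchedEvent [Nonempty X] (ω : List ℕ → List C)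
    (ht : t ≤ ℓ) {ε : ℝ} (hε : 0 < ε) :
    ∃ θ : ℝ, 0 < θ ∧ ∀ N,
      ∀ z ∈ matchedEvent ω ℓ fun ι => definedEvent M N \ nonuniformEvent M θ ι,
      |(multigraphOfLists N z.1).rootCorrelation M.ψ z.2 t
        - (truncatedTree ω ℓ).rootCorrelation M.ψ (treeRoot ω ℓ) t| < ε := by
  obtain ⟨θ, hθ, hnear⟩ := (isLayered_truncatedTree ω ℓ).exists_rootCorrelation_near M.ψ ht hε
  refine ⟨θ, hθ, ?_⟩
  rintro N ⟨g, _⟩ ⟨ι, hι, rfl, hg, hZ, huniform⟩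
  exact hnear N ι hι.injective g hg hZ fun ξ => not_le.1 fun hξ => huniform ⟨hZ, ξ, hξ⟩

theorem mem_matchedEvent_diff_or {N : ℕ} {B B' : (truncatedNodes ω ℓ → Fin N) →
    Set (Sym2 (Fin N) → List C)} {z : (Sym2 (Fin N) → List C) × Fin N}
    (hz : z ∈ matchedEvent ω ℓ B) :
    z ∈ matchedEvent ω ℓ (fun ι => B ι \ B' ι) ∨ z ∈ matchedEvent ω ℓ B' := by
  obtain ⟨ι, hι, hroot, hg, hB⟩ := hz
  by_cases hB' : removeTouching (innerSet (nodeDepth ω ℓ) ℓ) ι z.1 ∈ B' ι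
  · exact .inr ⟨ι, hι, hroot, hg, hB'⟩
  · exact .inl ⟨ι, hι, hroot, hg, hB, hB'⟩

theorem mem_matchedEvent_definedEvent {N : ℕ} {z : (Sym2 (Fin N) → List C) × Fin N}
    (hz : z ∈ matchedEvent ω ℓ fun _ => Set.univ) (hdefined : z.1 ∈ definedEvent M N) :
    z ∈ matchedEvent ω ℓ fun _ => definedEvent M N :=
  let ⟨ι, hι, hroot, hg, _⟩ := hz
  ⟨ι, hι, hroot, hg, partitionFunction_removeTouching_pos _ ι hdefined⟩

theorem setOf_le_rootCorrelation_subset {F : Finset (List ℕ → List C)} {θ : (List ℕ → List C) → ℝ}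
    {ε ε' : ℝ} {N : ℕ} (hε : 0 < ε)
    (hF : ∀ ω ∈ F, (truncatedTree ω ℓ).rootCorrelation M.ψ (treeRoot ω ℓ) t ≤ ε')
    (hnear : ∀ ω ∈ F, ∀ z ∈ matchedEvent ω ℓ fun ι => definedEvent M N \ nonuniformEvent M (θ ω) ι,
      |(multigraphOfLists N z.1).rootCorrelation M.ψ z.2 t
        - (truncatedTree ω ℓ).rootCorrelation M.ψ (treeRoot ω ℓ) t| < ε - ε') :
    {z | ε ≤ (multigraphOfLists N z.1).rootCorrelation M.ψ z.2 t}
      ⊆ (⋃ ω ∈ F, matchedEvent ω ℓ fun _ => Set.univ)ᶜ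
        ∪ ⋃ ω ∈ F, matchedEvent ω ℓ (nonuniformEvent M (θ ω)) := by
  refine fun z hz => or_iff_not_imp_left.2 fun hmatched => ?_
  obtain ⟨ω, hω, hzω⟩ := Set.mem_iUnion₂.1 (not_not.1 hmatched)
  have hdefined := partitionFunction_pos_of_rootCorrelation_pos (hε.trans_le hz)
  refine Set.mem_biUnion hω ((mem_matchedEvent_diff_or
    (mem_matchedEvent_definedEvent M hzω hdefined)).resolve_left fun hgood => ?_)
  rw [Set.mem_ofPred_eq] at hz
  linarith [(abs_lt.1 (hnear ω hω z hgood)).2, hF ω hω]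

variable [Countable C]

theorem mul_graphLaw_real_definedEvent_le (N : ℕ) :
    (M.rootedGraphLaw N).real (matchedEvent ω ℓ fun _ => Set.univ)
        * (M.graphLaw N).real (definedEvent M N)
      ≤ (M.rootedGraphLaw N).real (matchedEvent ω ℓ fun _ => definedEvent M N) := by
  classical
  simp only [rootedGraphLaw_real_matchedEvent, Set.preimage_univ, probReal_univ, mul_one]
  rw [div_mul_eq_mul_div, Finset.sum_mul]
  gcongr with ι
  · exact measure_ne_top _ _
  · exact fun g hg => partitionFunction_removeTouching_pos _ ι hg

variable [Nonempty X] (htype : ∀ a, Tendsto (fun N => M.typeSecondMoment N a) atTop (𝓝 0))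
include htype

theorem eventually_rootedGraphLaw_le_treeLaw (ht : t ≤ ℓ) {ε ε' κ : ℝ} (hε : 0 < ε)
    (hε' : ε' < ε) (hκ : 0 < κ) :
    ∀ᶠ N in atTop, (M.rootedGraphLaw N).real
        {z | ε ≤ (multigraphOfLists N z.1).rootCorrelation M.ψ z.2 t}
      ≤ M.treeLaw.real {ω | ε' < (truncatedTree ω ℓ).rootCorrelation M.ψ (treeRoot ω ℓ) t} + κ := by
  set S := {ω | (truncatedTree ω ℓ).rootCorrelation M.ψ (treeRoot ω ℓ) t ≤ ε'}
  have hSc : Sᶜ = {ω | ε' < (truncatedTree ω ℓ).rootCorrelation M.ψ (treeRoot ω ℓ) t} := by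
    ext
    simp [S]
  obtain ⟨F, hFS, hF, hFsum⟩ := exists_finset_treeLaw_lt_sum M (ℓ := ℓ) (S := S)
    (fun ω hω ω' hω' => by
      rwa [Set.mem_ofPred_eq, rootCorrelation_eq_of_mem_treeCylinder M.ψ hω'])
    (sub_lt_self _ (half_pos hκ))
  choose θ hθ hnear using fun ω : List ℕ → List C =>
    exists_rootCorrelation_near_of_mem_matchedEvent M ω ht (sub_pos.2 hε')
  have hlim : Tendsto (fun N => ∑ ω ∈ F, (M.rootedGraphLaw N).real
      (matchedEvent ω ℓ (nonuniformEvent M (θ ω)))) atTop (𝓝 0) := by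
    simpa using tendsto_finsetSum F fun ω _ =>
      tendsto_rootedGraphLaw_matchedEvent_nonuniformEvent M (hθ ω) htype
  filter_upwards [eventually_lt_rootedGraphLaw_real_matchedEvent M hF hFsum,
    hlim.eventually (gt_mem_nhds (half_pos hκ)), eventually_ne_atTop 0]
    with N hmatched hnonuniform hN
  have : NeZero N := ⟨hN⟩
  have hcover := setOf_le_rootCorrelation_subset M hε hFS fun ω _ => hnear ω N
  calc _ ≤ (M.rootedGraphLaw N).real (⋃ ω ∈ F, matchedEvent ω ℓ fun _ => Set.univ)ᶜ
          + (M.rootedGraphLaw N).real (⋃ ω ∈ F, matchedEvent ω ℓ (nonuniformEvent M (θ ω))) :=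
        (measureReal_mono hcover).trans (measureReal_union_le _ _)
    _ ≤ (1 - (M.treeLaw.real S - κ / 2)) + κ / 2 := by
        rw [probReal_compl_eq_one_sub .of_discrete]
        gcongr
        exact (measureReal_biUnion_finset_le _ _).trans hnonuniform.le
    _ ≤ M.treeLaw.real Sᶜ + κ := by
        have := measureReal_union_le (μ := M.treeLaw) S Sᶜ
        rw [Set.union_compl_self, probReal_univ] at this
        linarith
    _ = _ := by rw [hSc]

theorem exists_frequently_le_rootedGraphLaw (ht : t ≤ ℓ) {ε ε' δ : ℝ} (hε' : ε' < ε) (hδ : 0 < δ)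
    (hdefined : ∃ᶠ N in atTop, δ ≤ (M.graphLaw N).real (definedEvent M N))
    (hpos : 0 < M.treeLaw.real
      {ω | ε < (truncatedTree ω ℓ).rootCorrelation M.ψ (treeRoot ω ℓ) t}) :
    ∃ δ' : ℝ, 0 < δ' ∧ ∃ᶠ N in atTop, δ' ≤ (M.rootedGraphLaw N).real
        {z | ε' ≤ (multigraphOfLists N z.1).rootCorrelation M.ψ z.2 t} := by
  obtain ⟨F, hFS, -, hF⟩ := exists_finset_treeLaw_lt_sum M (ℓ := ℓ) (fun ω hω ω' hω' => by
    rwa [Set.mem_ofPred_eq, rootCorrelation_eq_of_mem_treeCylinder M.ψ hω']) hpos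
  obtain ⟨ω, hωF, hτ⟩ := Finset.exists_lt_of_sum_lt
    (Finset.sum_const_zero.trans_lt hF : ∑ _ω ∈ F, (0 : ℝ) < _)
  obtain ⟨θ, hθ, hnear⟩ :=
    exists_rootCorrelation_near_of_mem_matchedEvent M ω ht (sub_pos.2 hε')
  set τ := M.treeLaw.real (treeCylinder ω ℓ)
  have hmatched : ∀ᶠ N in atTop, τ / 2 < (M.rootedGraphLaw N).real
      (matchedEvent ω ℓ fun _ => Set.univ) := by
    simpa using eventually_lt_rootedGraphLaw_real_matchedEvent M (F := {ω}) (by simp)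
      (by rw [Finset.sum_singleton]; exact half_lt_self hτ)
  have hnonuniform := (tendsto_rootedGraphLaw_matchedEvent_nonuniformEvent M (ω := ω) (ℓ := ℓ)
    hθ htype).eventually (gt_mem_nhds (show 0 < τ * δ / 4 by positivity))
  refine ⟨τ * δ / 4, by positivity, (hdefined.and_eventually (hmatched.and hnonuniform)).mono ?_⟩
  rintro N ⟨hN, hNmatched, hNnonuniform⟩
  have hgood : matchedEvent ω ℓ (fun ι => definedEvent M N \ nonuniformEvent M θ ι)
      ⊆ {z | ε' ≤ (multigraphOfLists N z.1).rootCorrelation M.ψ z.2 t} := fun z hz => by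
    have hω : ε < (truncatedTree ω ℓ).rootCorrelation M.ψ (treeRoot ω ℓ) t := hFS hωF
    have := (abs_lt.1 (hnear N z hz)).1
    rw [Set.mem_ofPred_eq]
    linarith
  have hsplit : (M.rootedGraphLaw N).real (matchedEvent ω ℓ fun _ => definedEvent M N)
      ≤ (M.rootedGraphLaw N).real {z | ε' ≤ (multigraphOfLists N z.1).rootCorrelation M.ψ z.2 t}
        + (M.rootedGraphLaw N).real (matchedEvent ω ℓ (nonuniformEvent M θ)) :=
    (measureReal_mono fun z hz => (mem_matchedEvent_diff_or hz).imp_left (hgood ·)).trans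
      (measureReal_union_le _ _)
  have hproduct : τ / 2 * δ ≤ (M.rootedGraphLaw N).real (matchedEvent ω ℓ fun _ => .univ)
      * (M.graphLaw N).real (definedEvent M N) := by gcongr
  linarith [mul_graphLaw_real_definedEvent_le M (ω := ω) (ℓ := ℓ) N]

end Comparison

section Solvability

variable {X C : Type*} [Fintype X] [Countable C] [Nonempty X] {M : PoissonEnsemble X C}

theorem treeSolvable_of_graphSolvable (h : M.GraphSolvable)
    (htype : ∀ a, Tendsto (fun N => M.typeSecondMoment N a) atTop (𝓝 0)) : M.TreeSolvable := by
  obtain ⟨ε, hε, h⟩ := h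
  refine ⟨ε / 2, half_pos hε, fun t => withPositiveProbability_iff.2 ?_⟩
  obtain ⟨δ, hδ, hgraph⟩ := withPositiveProbability_iff.1 (h t)
  refine ⟨δ / 2, half_pos hδ, Eventually.frequently ?_⟩
  filter_upwards [eventually_ge_atTop t] with ℓ hℓ
  obtain ⟨N, hN, hNtree⟩ := (hgraph.and_eventually (eventually_rootedGraphLaw_le_treeLaw M htype hℓ
    hε (half_lt_self hε) (half_pos hδ))).exists
  linarith

theorem graphSolvable_of_treeSolvable (h : M.TreeSolvable) {δ : ℝ} (hδ : 0 < δ)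
    (hdefined : ∃ᶠ N in atTop, δ ≤ (M.graphLaw N).real (definedEvent M N))
    (htype : ∀ a, Tendsto (fun N => M.typeSecondMoment N a) atTop (𝓝 0)) : M.GraphSolvable := by
  obtain ⟨ε, hε, h⟩ := h
  refine ⟨ε / 2, half_pos hε, fun t => withPositiveProbability_iff.2 ?_⟩
  obtain ⟨κ, hκ, htree⟩ := withPositiveProbability_iff.1 (h t)
  obtain ⟨ℓ, hℓ, ht⟩ := (htree.and_eventually (eventually_ge_atTop t)).exists
  exact exists_frequently_le_rootedGraphLaw M htype ht (half_lt_self hε) hδ hdefined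
    (hκ.trans_le hℓ)

end Solvability

theorem theorem1_general {X C : Type*} [Fintype X] [Countable C] (M : PoissonEnsemble X C)
    (hdefined : WithPositiveProbability M.probDefined)
    (htype : ∀ a : X, Tendsto (fun N => M.typeSecondMoment N a) atTop (𝓝 0)) :
    M.GraphSolvable ↔ M.TreeSolvable := by
  obtain ⟨δ, hδ, hdefined⟩ := withPositiveProbability_iff.1 hdefined
  have := nonempty_of_frequently_definedEvent M hδ hdefined
  exact ⟨(treeSolvable_of_graphSolvable · htype),
    (graphSolvable_of_treeSolvable · hδ hdefined htype)⟩

theorem theorem1 {X C : Type*} [Fintype X] [Finite C] (M : PoissonEnsemble X C)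
    (hdefined : ∃ δ : ℝ≥0∞, 0 < δ ∧ ∀ᶠ N in atTop, δ ≤ M.probDefined N)
    (htype : ∀ a : X, Tendsto (fun N => M.typeSecondMoment N a) atTop (𝓝 0)) :
    M.GraphSolvable ↔ M.TreeSolvable :=
  theorem1_general M (hdefined.imp fun _ h => ⟨h.1, h.2.frequently⟩) htype
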